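/- Let $n\ge 2$, $q\ge 0$, $m\ge 2$ be integers. Let $\mathcal G$ be a strongly connected weighted digraph on $\{1,\dots,n\}$ with weights $a_{ik}\ge 0$, $a_{ii}=0$ (there is an edge from $k$ to $i$ iff $a_{ik}>0$), and Laplacian $L=\operatorname{diag}\big(\sum_k a_{1k},\dots,\sum_k a_{nk}\big)-[a_{ik}]$. Let $h=(h_1,\dots,h_n)$ be the left Perron eigenvector: $h_i>0$, $h^TL=0$, $\sum_i h_i=1$. Put $H=\operatorname{diag}(h_1,\dots,h_n)$, $\mathbf L=\tfrac12(HL+L^TH)$, let $\lambda_2(\mathbf L)$ be the second smallest eigenvalue of $\mathbf L$ (counted with multiplicity), and $h^*=\min_i h_i$. For each $i$ let $f_i^0:\mathbb R^q\to\mathbb R$ be twice continuously differentiable with $$(\nabla f_i^0(a)-\nabla f_i^0(b))^T(a-b)\ge c\,\|a-b\|^2\quad\text{for all }a,b\in\mathbb R^q,$$ where the constant $c>m-1$ does not depend on $i$, and let $f_i^1,\dots,f_i^m:\mathbb R^q\to(-\infty,+\infty]$ be lower semicontinuous proper convex functions, with proximal operators $\operatorname{prox}_{f}[\theta]=\arg\min_\delta\{f(\delta)+\tfrac12\|\delta-\theta\|^2\}$.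 Let $d_1,\dots,d_n\in\mathbb R^q$ and consider the resource allocation problem $$\min_{x\in(\mathbb R^q)^n}\ F(x)=\sum_{i=1}^n\sum_{j=0}^m f_i^j(x_i)\quad\text{subject to}\quad\sum_{i=1}^n x_i=\sum_{i=1}^n d_i .\qquad(P)$$ Assume that there is a point $y$ with $\sum_i y_i=\sum_i d_i$ such that, for all $i$ and all $j\in\{1,\dots,m\}$, $y_i$ lies in the relative interior of $\operatorname{dom} f_i^j=\{f_i^j<+\infty\}$. (When all $f_i^j$ are real-valued, this holds automatically.) Consider the dynamics, for $t\ge 0$, $i\in\{1,\dots,n\}$, $j\in\{1,\dots,m-1\}$, $$\begin{aligned} \dot x_i&=\operatorname{prox}_{f_i^m}\Big[x_i-\nabla f_i^0(x_i)+v_i+\gamma\sum_{j=1}^{m-1}z_i^j\Big]-x_i,\\ \dot z_i^j&=\operatorname{prox}_{f_i^j}\big[x_i-\gamma z_i^j\big]-x_i,\\ \dot v_i&=-h_i^{-1}(x_i-d_i)-\alpha\sum_{k}a_{ik}(v_i-v_k)-w_i,\\ \dot w_i&=\alpha\sum_{k}a_{ik}(v_i-v_k),\qquad w_i(0)=0 .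 \end{aligned}$$ Suppose that $$0<\gamma<\frac1{m-1},\qquad \frac{(1+\gamma)(m-1)}{2c}<\beta<\frac{2}{1+\gamma},\qquad b_2=c-\frac{(1+\gamma)(m-1)}{2\beta},$$ $$\eta>\max\Big\{\frac1{b_2h^*}-1,\,0\Big\},\qquad \alpha>\frac{(\eta+1)^2}{\eta\,\lambda_2(\mathbf L)} .$$ Then $(P)$ has exactly one solution; from all initial values $x(0),z(0),v(0)$, with $w(0)=0$, the dynamics has a trajectory defined on $[0,\infty)$; and along every such trajectory $x(t)$ converges as $t\to\infty$, and its limit is the solution of $(P)$. -/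

import Mathlib

open Set Filter Topology
open scoped Matrix Gradient

noncomputable section

namespace ResourceAllocation

/-! ### Weighted digraphs -/

/-- A weighted digraph on the nodes `Fin n`: there is an edge `e_ij` (node `i` receives information
from node `j`) exactly when `0 < a i j`; there are no self-loops. -/
structure WeightedDigraph (n : ℕ) where
  /-- the weighted adjacency matrix -/
  a : Matrix (Fin n) (Fin n) ℝ
  nonneg : ∀ i j, 0 ≤ a i j
  loopless : ∀ i, a i i = 0

/-- Every node can be reached from every node along directed edges. -/
def WeightedDigraph.StronglyConnected {n : ℕ} (G : WeightedDigraph n) : Prop :=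
  ∀ i j, Relation.ReflTransGen (fun k l => 0 < G.a k l) i j

/-- The in-degree Laplacian `L = D_in - A`, `(D_in)_ii = ∑ j, a i j`. -/
def WeightedDigraph.laplacian {n : ℕ} (G : WeightedDigraph n) : Matrix (Fin n) (Fin n) ℝ :=
  Matrix.diagonal (fun i => ∑ j, G.a i j) - G.a

/-- `h` is the positive left eigenvector of the Laplacian for the eigenvalue zero, normalised to
have sum one. -/
structure WeightedDigraph.IsLeftPerron {n : ℕ} (G : WeightedDigraph n) (h : Fin n → ℝ) : Prop where
  pos : ∀ i, 0 < h i
  left_null : h ᵥ* G.laplacian = 0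
  sum_eq_one : ∑ i, h i = 1

/-- The symmetrised weighted Laplacian `(H L + Lᵀ H) / 2` with `H = diag h`. -/
def WeightedDigraph.symLaplacian {n : ℕ} (G : WeightedDigraph n) (h : Fin n → ℝ) :
    Matrix (Fin n) (Fin n) ℝ :=
  (1 / 2 : ℝ) • (Matrix.diagonal h * G.laplacian + G.laplacianᵀ * Matrix.diagonal h)

theorem WeightedDigraph.symLaplacian_isHermitian {n : ℕ} (G : WeightedDigraph n)
    (h : Fin n → ℝ) : (G.symLaplacian h).IsHermitian := by
  unfold Matrix.IsHermitian WeightedDigraph.symLaplacian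
  simp [Matrix.conjTranspose_eq_transpose_of_trivial, Matrix.transpose_mul, add_comm]

/-- The second smallest eigenvalue, counted with multiplicity, of a real symmetric `n × n` matrix,
`2 ≤ n` (`eigenvalues₀` lists the eigenvalues in decreasing order). -/
def secondSmallestEigenvalue {n : ℕ} (hn : 2 ≤ n) {A : Matrix (Fin n) (Fin n) ℝ}
    (hA : A.IsHermitian) : ℝ :=
  hA.eigenvalues₀ ⟨n - 2, by rw [Fintype.card_fin]; omega⟩

/-! ### Extended-real-valued convex functions and the proximal operator -/

section Convex

variable {E : Type*} [NormedAddCommGroup E] [NormedSpace ℝ E]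

/-- The effective domain. -/
def effDomain (f : E → EReal) : Set E := {x | f x < ⊤}

/-- `f : E → (-∞, +∞]` is convex (its epigraph is convex), lower semicontinuous (closed), and
proper. -/
structure IsClosedProperConvex (f : E → EReal) : Prop where
  convex : Convex ℝ {p : E × ℝ | f p.1 ≤ (p.2 : EReal)}
  lsc : LowerSemicontinuous f
  ne_bot : ∀ x, f x ≠ ⊥
  domain_nonempty : (effDomain f).Nonempty

/-- `p` minimises `δ ↦ f δ + ‖δ - θ‖² / 2`. -/
def IsProxPoint (f : E → EReal) (θ p : E) : Prop :=
  ∀ δ, f p + ((1 / 2 * ‖p - θ‖ ^ 2 : ℝ) : EReal) ≤ f δ + ((1 / 2 * ‖δ - θ‖ ^ 2 : ℝ) : EReal)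

/-- The proximal operator `prox_f θ = argmin_δ (f δ + ‖δ - θ‖² / 2)`. -/
def prox (f : E → EReal) (θ : E) : E := Classical.epsilon (IsProxPoint f θ)

end Convex

/-! ### The resource allocation problem

Agent `i` has the smooth cost `f0 i` and the `m = r + 1` nonsmooth costs `f i j`, `j : Fin (r + 1)`.
The last of them, `f i (Fin.last r)`, is the one that is handled in the `x`-equation; the first
`r = m - 1`, `f i j.castSucc` with `j : Fin r`, are handled by the auxiliary variables `z j`. -/

section Problem

variable {n q r : ℕ}

/-- The global cost `F x = ∑ i, (f0 i (x i) + ∑ j, f i j (x i))`. -/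
def globalCost (f0 : Fin n → EuclideanSpace ℝ (Fin q) → ℝ)
    (f : Fin n → Fin (r + 1) → EuclideanSpace ℝ (Fin q) → EReal)
    (x : Fin n → EuclideanSpace ℝ (Fin q)) : EReal :=
  ∑ i, ((f0 i (x i) : EReal) + ∑ j, f i j (x i))

/-- Feasible points: the resource constraint holds and the cost is finite. -/
def IsFeasible (f0 : Fin n → EuclideanSpace ℝ (Fin q) → ℝ)
    (f : Fin n → Fin (r + 1) → EuclideanSpace ℝ (Fin q) → EReal)
    (d x : Fin n → EuclideanSpace ℝ (Fin q)) : Prop :=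
  ∑ i, x i = ∑ i, d i ∧ globalCost f0 f x < ⊤

/-- `x` solves `min F x` subject to `∑ i, x i = ∑ i, d i`. -/
def IsSolution (f0 : Fin n → EuclideanSpace ℝ (Fin q) → ℝ)
    (f : Fin n → Fin (r + 1) → EuclideanSpace ℝ (Fin q) → EReal)
    (d x : Fin n → EuclideanSpace ℝ (Fin q)) : Prop :=
  IsFeasible f0 f d x ∧
    ∀ y : Fin n → EuclideanSpace ℝ (Fin q), ∑ i, y i = ∑ i, d i →
      globalCost f0 f x ≤ globalCost f0 f y

/-- `(x, z, v, w)` is a trajectory, on the time interval `[0, ∞)`, of the multi-proximal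
primal-dual dynamics. At `t = 0` the derivative is the right derivative. -/
structure IsTrajectory (G : WeightedDigraph n) (h : Fin n → ℝ) (α γ : ℝ)
    (f0 : Fin n → EuclideanSpace ℝ (Fin q) → ℝ)
    (f : Fin n → Fin (r + 1) → EuclideanSpace ℝ (Fin q) → EReal)
    (d : Fin n → EuclideanSpace ℝ (Fin q))
    (x : ℝ → Fin n → EuclideanSpace ℝ (Fin q))
    (z : ℝ → Fin r → Fin n → EuclideanSpace ℝ (Fin q))
    (v w : ℝ → Fin n → EuclideanSpace ℝ (Fin q)) : Prop where
  deriv_x : ∀ t, 0 ≤ t → ∀ i, HasDerivWithinAt (fun s => x s i)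
    (prox (f i (Fin.last r)) (x t i - ∇ (f0 i) (x t i) + v t i + γ • ∑ j, z t j i) - x t i)
    (Ici 0) t
  deriv_z : ∀ t, 0 ≤ t → ∀ j i, HasDerivWithinAt (fun s => z s j i)
    (prox (f i j.castSucc) (x t i - γ • z t j i) - x t i) (Ici 0) t
  deriv_v : ∀ t, 0 ≤ t → ∀ i, HasDerivWithinAt (fun s => v s i)
    (-((h i)⁻¹ • (x t i - d i)) - α • ∑ k, G.laplacian i k • v t k - w t i) (Ici 0) t
  deriv_w : ∀ t, 0 ≤ t → ∀ i, HasDerivWithinAt (fun s => w s i)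
    (α • ∑ k, G.laplacian i k • v t k) (Ici 0) t
  init_w : w 0 = 0

end Problem

end ResourceAllocation

end

open ResourceAllocation

noncomputable section

namespace ResourceAllocation

/-! ### The Laplacian of a weight-unbalanced digraph -/

namespace WeightedDigraph

variable {n : ℕ} (G : WeightedDigraph n)

/-! Quadratic growth and lower semicontinuity give a minimiser, the relative interior point gives a
KKT multiplier (`IsSolution.exists_isKKT`), and strong convexity gives uniqueness. A KKT point
determines an equilibrium of the dynamics, and a Lyapunov function centred there yields both global
existence and convergence.

The dynamics couples agentwise proximal flows with a linear consensus system in `(v, w)`. For one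
agent, `proxPotential`, a primitive of the proximal operator, gives a storage function that can be
differentiated although `prox` is only Lipschitz. Its derivative (`hasDerivWithinAt_agentEnergy`) is
at most `-b₂ (‖x - xs‖² + ‖ẋ‖²)` plus the two supply terms `⟨v - lam, x - xs⟩` and `⟨v̇, ẋ⟩`. On the
consensus side, the form `½ ∑ h (η ‖V‖² + ‖V + W‖²)` has derivative at most `-(η + 1) ∑ ⟨V, X⟩ + K ∑
‖X‖²` with `K = 1 / h*` (`IsLeftPerron.dissipation`), where `α λ₂` pays for the product of `V` and
`W`. The system being linear, this holds for the deviations from equilibrium and for the time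
derivatives alike. Using both copies cancels both supply terms, and `(η + 1) b₂ > 1 / h*` makes the
remainder negative.

Coercivity is not immediate, since the agent energies are bounded below only up to a multiple of `⟨v
- lam, x - xs⟩`. The same dissipation inequality, read as a pointwise bound on this product, lets
the squares of the deviations and of the velocities be completed (`le_lyapunov`). Trajectories are
then bounded, and Barbalat's lemma applied to `∑ ‖x - xs‖²` gives the limit. The conserved identity
`∑ h w = 0`, where `w 0 = 0` enters, is needed throughout. -/

theorem sum_laplacian_smul {E : Type*} [AddCommGroup E] [Module ℝ E] (v : Fin n → E) (i : Fin n) :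
    ∑ k, G.laplacian i k • v k = ∑ k, G.a i k • (v i - v k) := by
  simp only [laplacian, Matrix.sub_apply, sub_smul, Finset.sum_sub_distrib, smul_sub]
  congr 1
  rw [← Finset.sum_smul, Finset.sum_eq_single i]
  · simp
  · intro k _ hk
    simp [Matrix.diagonal_apply_ne _ hk.symm]
  · simp

theorem sum_laplacian_smul_const {E : Type*} [AddCommGroup E] [Module ℝ E] (c : E) (i : Fin n) :
    ∑ k, G.laplacian i k • c = 0 := by
  rw [G.sum_laplacian_smul (fun _ => c)]
  simp

variable {G} {h : Fin n → ℝ}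

theorem IsLeftPerron.sum_mul_laplacian (hh : G.IsLeftPerron h) (k : Fin n) :
    ∑ i, h i * G.laplacian i k = 0 := by
  simpa [Matrix.vecMul, dotProduct] using congrFun hh.left_null k

theorem IsLeftPerron.sum_smul_laplacian {E : Type*} [AddCommGroup E] [Module ℝ E]
    (hh : G.IsLeftPerron h) (v : Fin n → E) :
    ∑ i, h i • ∑ k, G.laplacian i k • v k = 0 := by
  simp only [Finset.smul_sum, smul_smul]
  rw [Finset.sum_comm]
  simp [← Finset.sum_smul, hh.sum_mul_laplacian]

theorem IsLeftPerron.le_one (hh : G.IsLeftPerron h) (i : Fin n) : h i ≤ 1 := by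
  rw [← hh.sum_eq_one]
  exact Finset.single_le_sum (fun j _ => (hh.pos j).le) (Finset.mem_univ i)

/-- The Dirichlet form of a weight-unbalanced digraph. -/
theorem IsLeftPerron.energy_eq (hh : G.IsLeftPerron h) (v : Fin n → ℝ) :
    ∑ i, h i * (v i * ∑ k, G.laplacian i k * v k) =
      1 / 2 * ∑ i, ∑ k, h i * G.a i k * (v i - v k) ^ 2 := by
  have h1 : ∀ i, ∑ k, G.laplacian i k * v k = ∑ k, G.a i k * (v i - v k) := fun i => by
    simpa using G.sum_laplacian_smul v i
  -- Polarisation: `v i * (v i - v k)` is half of `(v i - v k) ^ 2` plus half of `v i ^ 2 - v k ^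
  -- 2`, and the second half sums to zero because `h` annihilates the Laplacian of the squares.
  have h2 := hh.sum_smul_laplacian (fun k => v k ^ 2)
  have h3 : ∀ i, ∑ k, G.laplacian i k * v k ^ 2 = ∑ k, G.a i k * (v i ^ 2 - v k ^ 2) := fun i => by
    simpa using G.sum_laplacian_smul (fun k => v k ^ 2) i
  simp only [smul_eq_mul, h3, Finset.mul_sum] at h2
  simp only [h1, Finset.mul_sum]
  calc _ = ∑ i, ∑ k, (1 / 2 * (h i * G.a i k * (v i - v k) ^ 2)
        + 1 / 2 * (h i * (G.a i k * (v i ^ 2 - v k ^ 2)))) := by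
        refine Finset.sum_congr rfl fun i _ => Finset.sum_congr rfl fun k _ => ?_
        ring
    _ = _ := by
        simp only [Finset.sum_add_distrib, ← Finset.mul_sum]
        simp only [Finset.mul_sum] at h2 ⊢
        simp only [← Finset.mul_sum] at h2 ⊢
        rw [h2]
        ring

theorem symLaplacian_mulVec (v : Fin n → ℝ) (i : Fin n) :
    (G.symLaplacian h *ᵥ v) i =
      1 / 2 * (h i * ∑ k, G.laplacian i k * v k + ∑ k, G.laplacian k i * (h k * v k)) := by
  simp only [symLaplacian, Matrix.smul_mulVec, Matrix.add_mulVec, ← Matrix.mulVec_mulVec,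
    Pi.smul_apply, Pi.add_apply, Matrix.mulVec_diagonal, smul_eq_mul]
  simp only [Matrix.mulVec, dotProduct, Matrix.transpose_apply, Matrix.diagonal_apply]
  simp

theorem dotProduct_symLaplacian_mulVec (v : Fin n → ℝ) :
    v ⬝ᵥ (G.symLaplacian h *ᵥ v) = ∑ i, h i * (v i * ∑ k, G.laplacian i k * v k) := by
  simp only [dotProduct, symLaplacian_mulVec]
  have h1 : ∑ i, v i * ∑ k, G.laplacian k i * (h k * v k) =
      ∑ i, h i * (v i * ∑ k, G.laplacian i k * v k) := by
    simp only [Finset.mul_sum]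
    rw [Finset.sum_comm]
    refine Finset.sum_congr rfl fun i _ => Finset.sum_congr rfl fun k _ => ?_
    ring
  calc _ = 1 / 2 * (∑ i, h i * (v i * ∑ k, G.laplacian i k * v k)
        + ∑ i, v i * ∑ k, G.laplacian k i * (h k * v k)) := by
        rw [← Finset.sum_add_distrib, Finset.mul_sum]
        refine Finset.sum_congr rfl fun i _ => ?_
        ring
    _ = _ := by rw [h1]; ring

theorem IsLeftPerron.symLaplacian_mulVec_one (hh : G.IsLeftPerron h) :
    G.symLaplacian h *ᵥ (fun _ => 1) = 0 := by
  ext i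
  have h1 : ∑ k, G.laplacian i k * (1 : ℝ) = 0 := by
    simpa using G.sum_laplacian_smul_const (1 : ℝ) i
  have h2 := hh.sum_mul_laplacian i
  rw [symLaplacian_mulVec, h1]
  simp only [mul_one, mul_comm _ (h _), h2]
  simp

/-- The form is a sum of nonnegative edge terms, so a nonpositive value forces equality across every
edge; directed paths then reach all pairs. -/
theorem IsLeftPerron.eq_of_energy_nonpos (hh : G.IsLeftPerron h) (hG : G.StronglyConnected)
    {v : Fin n → ℝ} (hv : v ⬝ᵥ (G.symLaplacian h *ᵥ v) ≤ 0) (i j : Fin n) : v i = v j := by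
  rw [dotProduct_symLaplacian_mulVec, hh.energy_eq] at hv
  have hnn : ∀ i k, 0 ≤ h i * G.a i k * (v i - v k) ^ 2 := fun i k =>
    mul_nonneg (mul_nonneg (hh.pos i).le (G.nonneg i k)) (sq_nonneg _)
  have h0 : ∑ i, ∑ k, h i * G.a i k * (v i - v k) ^ 2 = 0 :=
    le_antisymm (by linarith) (Finset.sum_nonneg fun i _ => Finset.sum_nonneg fun k _ => hnn i k)
  have h1 : ∀ k l, 0 < G.a k l → v k = v l := fun k l hkl => by
    have h2 := (Finset.sum_eq_zero_iff_of_nonneg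
      (fun i _ => Finset.sum_nonneg fun k _ => hnn i k)).1 h0 k (Finset.mem_univ k)
    have h3 := (Finset.sum_eq_zero_iff_of_nonneg (fun l _ => hnn k l)).1 h2 l (Finset.mem_univ l)
    have h4 : (v k - v l) ^ 2 = 0 :=
      (mul_eq_zero.1 h3).resolve_left (mul_pos (hh.pos k) hkl).ne'
    exact sub_eq_zero.1 (pow_eq_zero_iff two_ne_zero |>.1 h4)
  induction hG i j with
  | refl => rfl
  | tail _ hkl ih => exact ih.trans (h1 _ _ hkl)

/-- The second smallest eigenvalue of the symmetrised Laplacian is positive, and bounds its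
quadratic form from below off the consensus subspace. -/
theorem IsLeftPerron.spectral_gap (hh : G.IsLeftPerron h) (hG : G.StronglyConnected) (hn : 2 ≤ n) :
    0 < secondSmallestEigenvalue hn (G.symLaplacian_isHermitian h) ∧
    ∀ v : Fin n → ℝ, ∑ i, v i = 0 →
      secondSmallestEigenvalue hn (G.symLaplacian_isHermitian h) * ∑ i, v i ^ 2 ≤
        ∑ i, h i * (v i * ∑ k, G.laplacian i k * v k) := by
  set hA := G.symLaplacian_isHermitian h
  set e : Fin (Fintype.card (Fin n)) ≃ Fin n := Fintype.equivOfCardEq (Fintype.card_fin _)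
  set b := hA.eigenvectorBasis
  have hcard : Fintype.card (Fin n) = n := Fintype.card_fin n
  -- The eigenvalues decrease along `Fin`, so `s` indexes the second smallest and `l` the smallest.
  set s : Fin (Fintype.card (Fin n)) := ⟨n - 2, by omega⟩ with hs
  set l : Fin (Fintype.card (Fin n)) := ⟨n - 1, by omega⟩ with hl
  set lam := secondSmallestEigenvalue hn hA with hlam
  have hlams : hA.eigenvalues (e s) = lam := by
    simp [Matrix.IsHermitian.eigenvalues, hlam, secondSmallestEigenvalue, e, s]
  have hanti : ∀ i j, i ≤ j → hA.eigenvalues (e j) ≤ hA.eigenvalues (e i) := fun i j hij => by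
    simpa [Matrix.IsHermitian.eigenvalues, e] using hA.eigenvalues₀_antitone hij
  have hquad : ∀ i, (b i).ofLp ⬝ᵥ (G.symLaplacian h *ᵥ (b i).ofLp) = hA.eigenvalues i := fun i => by
    have h1 := hA.mulVec_eigenvectorBasis i
    rw [show G.symLaplacian h *ᵥ (b i).ofLp = hA.eigenvalues i • (b i).ofLp from h1]
    have h2 : (b i).ofLp ⬝ᵥ (b i).ofLp = 1 := by
      have h3 := b.orthonormal.1 i
      have h4 := EuclideanSpace.real_norm_sq_eq (b i)
      rw [h3] at h4
      simp only [dotProduct, ← pow_two]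
      simpa using h4.symm
    rw [dotProduct_smul, h2, smul_eq_mul, mul_one]
  -- Otherwise the eigenvectors at `s` and `l` would both be consensus vectors, and two of these
  -- cannot be orthonormal.
  have hpos : 0 < lam := by
    by_contra hle
    push Not at hle
    have hcs := hh.eq_of_energy_nonpos hG (v := (b (e s)).ofLp) (by rw [hquad, hlams]; exact hle)
    have hcl := hh.eq_of_energy_nonpos hG (v := (b (e l)).ofLp) (by
      rw [hquad]; exact (hanti s l (by simp only [hs, hl, Fin.mk_le_mk]; omega)).trans
        (hlams.trans_le hle))
    have hne : e s ≠ e l := fun h => by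
      have := congrArg Fin.val (e.injective h)
      simp only [hs, hl] at this
      omega
    have horth : inner ℝ (b (e s)) (b (e l)) = 0 := b.orthonormal.2 hne
    set i0 : Fin n := ⟨0, by omega⟩
    have hs1 := b.orthonormal.1 (e s)
    have hl1 := b.orthonormal.1 (e l)
    have hcs' : b (e s) = (b (e s)).ofLp i0 • WithLp.toLp 2 (fun _ => (1 : ℝ)) := by
      ext i; simpa using hcs i i0
    have hcl' : b (e l) = (b (e l)).ofLp i0 • WithLp.toLp 2 (fun _ => (1 : ℝ)) := by
      ext i; simpa using hcl i i0
    rw [hcs', hcl', inner_smul_left, inner_smul_right] at horth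
    rw [hcs', norm_smul] at hs1
    rw [hcl', norm_smul] at hl1
    rw [real_inner_self_eq_norm_sq] at horth
    simp only [conj_trivial, mul_eq_zero, pow_eq_zero_iff two_ne_zero] at horth
    rcases horth with h | h | h
    · rw [h] at hs1; simp at hs1
    · rw [h] at hl1; simp at hl1
    · rw [h] at hl1; simp at hl1
  refine ⟨hpos, fun v hv => ?_⟩
  have hge : ∀ i, i ≠ e l → lam ≤ hA.eigenvalues i := fun i hi => by
    obtain ⟨k, rfl⟩ := e.surjective i
    rw [← hlams]
    refine hanti k s ?_
    have hk : k ≠ l := fun h => hi (by rw [h])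
    have hk' : (k : ℕ) ≠ n - 1 := fun h => hk (Fin.ext h)
    have := k.2
    simp only [hs, Fin.le_def]
    omega
  have hsym : ∀ (u w : Fin n → ℝ), u ⬝ᵥ (G.symLaplacian h *ᵥ w) = (G.symLaplacian h *ᵥ u) ⬝ᵥ w := by
    intro u w
    rw [Matrix.dotProduct_mulVec, ← Matrix.mulVec_transpose,
      ← Matrix.conjTranspose_eq_transpose_of_trivial, hA.eq]
  have hin : ∀ x y : EuclideanSpace ℝ (Fin n), inner ℝ x y = x.ofLp ⬝ᵥ y.ofLp := fun x y => by
    rw [EuclideanSpace.inner_eq_star_dotProduct, star_trivial, dotProduct_comm]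
  -- The constant vector is in the kernel and all eigenvalues except the one at `l` are positive, so
  -- it is orthogonal to all other eigenvectors. It thus spans the line of the last one, and a
  -- vector of zero sum has no component there.
  have hone : ∀ i, i ≠ e l → inner ℝ (b i) (WithLp.toLp 2 (fun _ : Fin n => (1 : ℝ))) = 0 := by
    intro i hi
    have h1 : (b i).ofLp ⬝ᵥ (G.symLaplacian h *ᵥ fun _ => (1 : ℝ)) = 0 := by
      rw [hh.symLaplacian_mulVec_one, dotProduct_zero]
    rw [hsym, show G.symLaplacian h *ᵥ (b i).ofLp = hA.eigenvalues i • (b i).ofLp from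
      hA.mulVec_eigenvectorBasis i, smul_dotProduct, smul_eq_mul] at h1
    rw [hin]
    exact (mul_eq_zero.1 h1).resolve_left (hpos.trans_le (hge i hi)).ne'
  set x : EuclideanSpace ℝ (Fin n) := WithLp.toLp 2 v
  have hx1 : inner ℝ x (WithLp.toLp 2 (fun _ : Fin n => (1 : ℝ))) = 0 := by
    rw [hin]; simpa [x, dotProduct] using hv
  have hbl : inner ℝ (b (e l)) x = 0 := by
    set one : EuclideanSpace ℝ (Fin n) := WithLp.toLp 2 (fun _ : Fin n => (1 : ℝ)) with hone_def
    have h1 := b.sum_inner_mul_inner x one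
    rw [Finset.sum_eq_single (e l) (fun i _ hi => by rw [hone i hi, mul_zero]) (by simp), hx1] at h1
    have h2 := b.sum_inner_mul_inner one one
    rw [Finset.sum_eq_single (e l) (fun i _ hi => by rw [hone i hi, mul_zero]) (by simp)] at h2
    have h3 : inner ℝ (b (e l)) one ≠ 0 := by
      intro h0
      have h4 : one.ofLp ⬝ᵥ one.ofLp = n := by simp [hone_def, dotProduct]
      rw [h0, mul_zero, hin, h4] at h2
      have h5 : n = 0 := by exact_mod_cast h2.symm
      omega
    rw [real_inner_comm]
    exact (mul_eq_zero.1 h1).resolve_right h3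
  have hT : v ⬝ᵥ (G.symLaplacian h *ᵥ v) = ∑ i, hA.eigenvalues i * inner ℝ (b i) x ^ 2 := by
    have h1 := b.sum_inner_mul_inner x (WithLp.toLp 2 (G.symLaplacian h *ᵥ v))
    rw [hin] at h1
    rw [show v ⬝ᵥ (G.symLaplacian h *ᵥ v) = x.ofLp ⬝ᵥ (WithLp.toLp 2
      (G.symLaplacian h *ᵥ v) : EuclideanSpace ℝ (Fin n)).ofLp from rfl, ← h1]
    refine Finset.sum_congr rfl fun i _ => ?_
    have h2 : inner ℝ (b i) (WithLp.toLp 2 (G.symLaplacian h *ᵥ v)) =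
        hA.eigenvalues i * inner ℝ (b i) x := by
      rw [hin, hin]
      change (b i).ofLp ⬝ᵥ (G.symLaplacian h *ᵥ v) = _
      rw [hsym, show G.symLaplacian h *ᵥ (b i).ofLp = hA.eigenvalues i • (b i).ofLp from
        hA.mulVec_eigenvectorBasis i, smul_dotProduct, smul_eq_mul]
    rw [h2, real_inner_comm]
    ring
  have hN : ∑ i, v i ^ 2 = ∑ i, inner ℝ (b i) x ^ 2 := by
    have h1 := b.sum_sq_norm_inner_right x
    simp only [Real.norm_eq_abs, sq_abs] at h1
    rw [h1, EuclideanSpace.real_norm_sq_eq]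
  rw [← dotProduct_symLaplacian_mulVec, hT, hN, Finset.mul_sum]
  refine Finset.sum_le_sum fun i _ => ?_
  by_cases hi : i = e l
  · rw [hi, hbl]; simp
  · exact mul_le_mul_of_nonneg_right (hge i hi) (sq_nonneg _)

theorem IsLeftPerron.spectral_gap_of_sum_eq_zero {q : ℕ} (hh : G.IsLeftPerron h)
    (hG : G.StronglyConnected) (hn : 2 ≤ n) {V : Fin n → EuclideanSpace ℝ (Fin q)}
    (hV : ∑ i, V i = 0) :
    secondSmallestEigenvalue hn (G.symLaplacian_isHermitian h) * ∑ i, ‖V i‖ ^ 2 ≤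
      ∑ i, h i * inner ℝ (V i) (∑ k, G.laplacian i k • V k) := by
  have key := fun l : Fin q => (hh.spectral_gap hG hn).2 (fun i => V i l) (by
    simpa using congrArg (fun x : EuclideanSpace ℝ (Fin q) => x l) hV)
  have h1 := Finset.sum_le_sum fun l (_ : l ∈ Finset.univ) => key l
  simp only [← Finset.mul_sum] at h1
  rw [Finset.sum_comm] at h1
  simp only [EuclideanSpace.real_norm_sq_eq]
  refine h1.trans (le_of_eq ?_)
  rw [Finset.sum_comm]
  refine Finset.sum_congr rfl fun i _ => ?_
  rw [← Finset.mul_sum, EuclideanSpace.inner_eq_star_dotProduct]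
  simp [dotProduct, mul_comm]

/-- The unweighted mean serves as `m`. The form does not see the shift: `L` kills constants on the
right and `h` kills the range of `L` on the left. -/
theorem IsLeftPerron.exists_spectral_gap {q : ℕ} (hh : G.IsLeftPerron h)
    (hG : G.StronglyConnected) (hn : 2 ≤ n) (V : Fin n → EuclideanSpace ℝ (Fin q)) :
    ∃ m, secondSmallestEigenvalue hn (G.symLaplacian_isHermitian h) * ∑ i, ‖V i - m‖ ^ 2 ≤
      ∑ i, h i * inner ℝ (V i) (∑ k, G.laplacian i k • V k) := by
  have hn0 : (n : ℝ) ≠ 0 := by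
    have : n ≠ 0 := by omega
    exact_mod_cast this
  set m := (n : ℝ)⁻¹ • ∑ i, V i with hm
  refine ⟨m, ?_⟩
  have hs : ∑ i, (V i - m) = 0 := by
    rw [Finset.sum_sub_distrib, Finset.sum_const, Finset.card_univ, Fintype.card_fin, hm,
      ← Nat.cast_smul_eq_nsmul ℝ, smul_smul, mul_inv_cancel₀ hn0, one_smul, sub_self]
  refine (hh.spectral_gap_of_sum_eq_zero hG hn hs).trans (le_of_eq ?_)
  simp only [smul_sub, Finset.sum_sub_distrib, sum_laplacian_smul_const, sub_zero, inner_sub_left,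
    mul_sub]
  have h1 : ∑ i, h i * inner ℝ m (∑ k, G.laplacian i k • V k) = 0 := by
    have := congrArg (inner ℝ m) (hh.sum_smul_laplacian V)
    simpa [inner_sum, inner_smul_right] using this
  rw [h1, sub_zero]

/-- Dissipation of the consensus part of the dynamics. -/
theorem IsLeftPerron.dissipation {q : ℕ} (hh : G.IsLeftPerron h) (hG : G.StronglyConnected)
    (hn : 2 ≤ n) {α η K : ℝ} (hη : 0 < η)
    (hα : (η + 1) ^ 2 / (η * secondSmallestEigenvalue hn (G.symLaplacian_isHermitian h)) < α)
    (hK : ∀ i, (h i)⁻¹ ≤ K) (X V W A B : Fin n → EuclideanSpace ℝ (Fin q))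
    (hW : ∑ i, h i • W i = 0) (hB : ∀ i, B i = α • ∑ k, G.laplacian i k • V k)
    (hA : ∀ i, A i = -((h i)⁻¹ • X i) - B i - W i) :
    ∑ i, h i * (η * inner ℝ (V i) (A i) + inner ℝ (V i + W i) (A i + B i)) ≤
      -(η + 1) * ∑ i, inner ℝ (V i) (X i) + K * ∑ i, ‖X i‖ ^ 2 - 1 / 2 * ∑ i, h i * ‖W i‖ ^ 2 := by
  set lam := secondSmallestEigenvalue hn (G.symLaplacian_isHermitian h) with hlam
  have hlam0 : 0 < lam := (hh.spectral_gap hG hn).1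
  obtain ⟨m, hm⟩ := hh.exists_spectral_gap hG hn V
  rw [← hlam] at hm
  have hα' : (η + 1) ^ 2 ≤ η * α * lam := by
    have h1 : 0 < η * lam := mul_pos hη hlam0
    have h2 := (div_lt_iff₀ h1).1 hα
    linarith
  have hα0 : 0 < α := lt_trans (div_pos (by positivity) (mul_pos hη hlam0)) hα
  have hWm : ∑ i, h i * inner ℝ m (W i) = 0 := by
    have := congrArg (inner ℝ m) hW
    simpa [inner_sum, inner_smul_right] using this
  have hterm : ∀ i, h i * (η * inner ℝ (V i) (A i) + inner ℝ (V i + W i) (A i + B i)) ≤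
      -(η + 1) * inner ℝ (V i) (X i) + K * ‖X i‖ ^ 2 - 1 / 2 * (h i * ‖W i‖ ^ 2)
      - η * α * (h i * inner ℝ (V i) (∑ k, G.laplacian i k • V k))
      + (η + 1) ^ 2 * ‖V i - m‖ ^ 2 - (η + 1) * (h i * inner ℝ m (W i)) := by
    intro i
    have hp := hh.pos i
    -- The Laplacian term cancels in `A i + B i`, which is the reason for building the quadratic
    -- form on `V + W`.
    have hsum : A i + B i = -((h i)⁻¹ • X i) - W i := by rw [hA]; abel
    rw [hsum, hA, hB]
    -- The part with `m` disappears after weighted summation by `hWm`; only the deviation `V i - m`,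
    -- controlled by the spectral gap, has to be absorbed.
    have e1 : inner ℝ (V i) (W i) = inner ℝ (V i - m) (W i) + inner ℝ m (W i) := by
      rw [inner_sub_left]; ring
    simp only [inner_add_left, inner_sub_right, inner_neg_right, inner_smul_right]
    rw [e1, real_inner_self_eq_norm_sq]
    set S := inner ℝ (V i) (∑ k, G.laplacian i k • V k)
    -- Here and in `y2` Young's inequality spends a quarter of `h i * ‖W i‖ ^ 2`, so half of it
    -- survives in the conclusion.
    have y1 : -(inner ℝ (W i) (X i)) ≤ K * ‖X i‖ ^ 2 + 1 / 4 * (h i * ‖W i‖ ^ 2) := by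
      have a1 : -(inner ℝ (W i) (X i)) ≤ ‖W i‖ * ‖X i‖ :=
        (neg_le_abs _).trans (abs_real_inner_le_norm _ _)
      have a2 : (h i)⁻¹ * ‖X i‖ ^ 2 ≤ K * ‖X i‖ ^ 2 :=
        mul_le_mul_of_nonneg_right (hK i) (sq_nonneg _)
      have a3 : ‖W i‖ * ‖X i‖ ≤ (h i)⁻¹ * ‖X i‖ ^ 2 + 1 / 4 * (h i * ‖W i‖ ^ 2) := by
        have a4 : (h i)⁻¹ * ‖X i‖ ^ 2 + 1 / 4 * (h i * ‖W i‖ ^ 2) - ‖W i‖ * ‖X i‖ =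
            (h i)⁻¹ * (‖X i‖ - 1 / 2 * (h i * ‖W i‖)) ^ 2 := by
          field_simp
          ring
        have a5 : 0 ≤ (h i)⁻¹ * (‖X i‖ - 1 / 2 * (h i * ‖W i‖)) ^ 2 := by positivity
        linarith
      linarith
    have y2 : -((η + 1) * (h i * inner ℝ (V i - m) (W i))) ≤
        (η + 1) ^ 2 * ‖V i - m‖ ^ 2 + 1 / 4 * (h i * ‖W i‖ ^ 2) := by
      have a1 : -(inner ℝ (V i - m) (W i)) ≤ ‖V i - m‖ * ‖W i‖ :=
        (neg_le_abs _).trans (abs_real_inner_le_norm _ _)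
      have a2 : h i * (-((η + 1) * inner ℝ (V i - m) (W i))) ≤
          h i * ((η + 1) ^ 2 * ‖V i - m‖ ^ 2 + 1 / 4 * ‖W i‖ ^ 2) := by
        refine mul_le_mul_of_nonneg_left ?_ hp.le
        nlinarith [sq_nonneg ((η + 1) * ‖V i - m‖ - 1 / 2 * ‖W i‖)]
      have a3 : h i * ((η + 1) ^ 2 * ‖V i - m‖ ^ 2) ≤ (η + 1) ^ 2 * ‖V i - m‖ ^ 2 :=
        mul_le_of_le_one_left (by positivity) (hh.le_one i)
      linarith
    have e2 : h i * (h i)⁻¹ = 1 := mul_inv_cancel₀ hp.ne'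
    have e3 : ∀ a b c d : ℝ, h i * (η * (-((h i)⁻¹ * a) - b - c) +
        (-((h i)⁻¹ * (a + d)) - (c + ‖W i‖ ^ 2))) =
        -(η + 1) * a - η * (h i * b) - (η + 1) * (h i * c) - d - h i * ‖W i‖ ^ 2 := by
      intro a b c d
      linear_combination (-(η + 1) * a - d) * e2
    rw [e3]
    linarith
  have hsum := Finset.sum_le_sum fun i (_ : i ∈ Finset.univ) => hterm i
  simp only [Finset.sum_add_distrib, Finset.sum_sub_distrib, ← Finset.mul_sum] at hsum
  rw [hWm] at hsum
  have h1 : (η + 1) ^ 2 * ∑ i, ‖V i - m‖ ^ 2 ≤ η * α * (lam * ∑ i, ‖V i - m‖ ^ 2) := by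
    have : 0 ≤ ∑ i, ‖V i - m‖ ^ 2 := Finset.sum_nonneg fun i _ => sq_nonneg _
    nlinarith
  have h2 := mul_le_mul_of_nonneg_left hm (mul_pos hη hα0).le
  linarith

end WeightedDigraph

/-! ### Closed proper convex functions and their proximal operators -/

section Minimizers

theorem exists_forall_le_of_quadratic_growth {X : Type*} [NormedAddCommGroup X] [ProperSpace X]
    {g : X → EReal} (hg : LowerSemicontinuous g) {S : Set X} (hS : IsClosed S) {x₀ : X}
    (hx₀ : x₀ ∈ S) (h₀ : g x₀ < ⊤) {a b : ℝ} (ha : 0 < a)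
    (hgb : ∀ x, ((a * ‖x‖ ^ 2 - b : ℝ) : EReal) ≤ g x) :
    ∃ x ∈ S, ∀ y ∈ S, g x ≤ g y := by
  obtain ⟨M, hM⟩ : ∃ M : ℝ, g x₀ = M := by
    refine ⟨(g x₀).toReal, (EReal.coe_toReal h₀.ne fun h => ?_).symm⟩
    have := hgb x₀
    rw [h] at this
    exact EReal.coe_ne_bot _ (le_bot_iff.1 this)
  -- Outside this ball the growth bound exceeds `M`; the entry `1` ensures `‖y‖ ≤ ‖y‖ ^ 2` there.
  set R : ℝ := max ‖x₀‖ (max 1 ((M + b) / a))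
  have hK : IsCompact (S ∩ Metric.closedBall 0 R) :=
    (isCompact_closedBall 0 R).inter_left hS
  have hx₀K : x₀ ∈ S ∩ Metric.closedBall 0 R := ⟨hx₀, by simp [R]⟩
  obtain ⟨x, hx, hmin⟩ := (hg.lowerSemicontinuousOn _).exists_isMinOn ⟨x₀, hx₀K⟩ hK
  refine ⟨x, hx.1, fun y hy => ?_⟩
  by_cases hyR : y ∈ Metric.closedBall 0 R
  · exact hmin ⟨hy, hyR⟩
  · have hyR' : R < ‖y‖ := by simpa using hyR
    refine (hmin hx₀K).trans ?_
    refine le_trans ?_ (hgb y)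
    rw [hM, EReal.coe_le_coe_iff]
    have h1 : 1 < ‖y‖ := lt_of_le_of_lt ((le_max_left _ _).trans (le_max_right _ _)) hyR'
    have h2 : (M + b) / a < ‖y‖ := lt_of_le_of_lt ((le_max_right _ _).trans (le_max_right _ _)) hyR'
    rw [div_lt_iff₀ ha] at h2
    nlinarith [mul_pos ha (by linarith : 0 < ‖y‖)]

end Minimizers

section Convex

variable {E : Type*} [NormedAddCommGroup E] [InnerProductSpace ℝ E] {f : E → EReal}

/-- `u` is a subgradient of `f` at `p`. -/
def IsSubgradientAt (f : E → EReal) (u p : E) : Prop :=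
  p ∈ effDomain f ∧
    ∀ δ ∈ effDomain f, (f p).toReal + inner ℝ u (δ - p) ≤ (f δ).toReal

theorem IsSubgradientAt.monotone {u u' p p' : E} (h : IsSubgradientAt f u p)
    (h' : IsSubgradientAt f u' p') : 0 ≤ inner ℝ (u - u') (p - p') := by
  have h1 := h.2 p' h'.1
  have h2 := h'.2 p h.1
  have h3 : inner ℝ u (p' - p) = - inner ℝ u (p - p') := by
    rw [← inner_neg_right, neg_sub]
  rw [inner_sub_left]
  linarith

theorem IsClosedProperConvex.coe_toReal (hf : IsClosedProperConvex f) {x : E}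
    (hx : x ∈ effDomain f) : ((f x).toReal : EReal) = f x :=
  EReal.coe_toReal (ne_of_lt hx) (hf.ne_bot x)

theorem IsClosedProperConvex.convexOn (hf : IsClosedProperConvex f) :
    ConvexOn ℝ (effDomain f) (fun x => (f x).toReal) := by
  have key : ∀ x ∈ effDomain f, ∀ y ∈ effDomain f, ∀ a b : ℝ, 0 ≤ a → 0 ≤ b → a + b = 1 →
      f (a • x + b • y) ≤ ((a * (f x).toReal + b * (f y).toReal : ℝ) : EReal) := by
    intro x hx y hy a b ha hb hab
    have h1 : ((x, (f x).toReal) : E × ℝ) ∈ {p : E × ℝ | f p.1 ≤ (p.2 : EReal)} :=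
      (hf.coe_toReal hx).ge
    have h2 : ((y, (f y).toReal) : E × ℝ) ∈ {p : E × ℝ | f p.1 ≤ (p.2 : EReal)} :=
      (hf.coe_toReal hy).ge
    simpa using hf.convex h1 h2 ha hb hab
  have hdom : ∀ x ∈ effDomain f, ∀ y ∈ effDomain f, ∀ a b : ℝ, 0 ≤ a → 0 ≤ b → a + b = 1 →
      a • x + b • y ∈ effDomain f := fun x hx y hy a b ha hb hab =>
    (key x hx y hy a b ha hb hab).trans_lt (EReal.coe_lt_top _)
  refine ⟨fun x hx y hy a b ha hb hab => hdom x hx y hy a b ha hb hab, ?_⟩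
  intro x hx y hy a b ha hb hab
  have h1 := key x hx y hy a b ha hb hab
  rw [← hf.coe_toReal (hdom x hx y hy a b ha hb hab), EReal.coe_le_coe_iff] at h1
  simpa using h1

/-- A closed proper convex function is bounded below by a function of linear growth. -/
theorem IsClosedProperConvex.exists_linear_lower_bound [ProperSpace E]
    (hf : IsClosedProperConvex f) :
    ∃ K : ℝ, 0 ≤ K ∧ ∀ x, ((-(K * (1 + ‖x‖)) : ℝ) : EReal) ≤ f x := by
  obtain ⟨x₀, hx₀⟩ := hf.domain_nonempty
  obtain ⟨p, hp, hmin⟩ := (hf.lsc.lowerSemicontinuousOn _).exists_isMinOn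
    ⟨x₀, Metric.mem_closedBall_self zero_le_one⟩ (isCompact_closedBall x₀ 1)
  have hpd : p ∈ effDomain f :=
    lt_of_le_of_lt (isMinOn_iff.1 hmin x₀ (Metric.mem_closedBall_self zero_le_one)) hx₀
  set M := |(f p).toReal| + |(f x₀).toReal|
  have hM : 0 ≤ M := by positivity
  refine ⟨M * (1 + ‖x₀‖), by positivity, fun x => ?_⟩
  by_cases hx : x ∈ effDomain f
  swap
  · have : f x = ⊤ := by simpa [effDomain] using hx
    rw [this]; exact le_top
  rw [← hf.coe_toReal hx, EReal.coe_le_coe_iff]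
  -- The point at parameter `R⁻¹` from `x₀` towards `x` lies in the unit ball, where `f` is at least
  -- `f p`; convexity along the segment transfers the bound to `x`.
  set R := 1 + ‖x - x₀‖ with hR
  have hR0 : 0 < R := by positivity
  have hRi : 0 ≤ 1 - R⁻¹ := by
    rw [sub_nonneg]
    exact inv_le_one_of_one_le₀ (by rw [hR]; linarith [norm_nonneg (x - x₀)])
  have hRi' : 0 ≤ R⁻¹ := by positivity
  have hc := hf.convexOn.2 hx₀ hx hRi hRi' (by ring)
  have hd := hf.convexOn.1 hx₀ hx hRi hRi' (by ring)
  have hball : (1 - R⁻¹) • x₀ + R⁻¹ • x ∈ Metric.closedBall x₀ 1 := by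
    rw [mem_closedBall_iff_norm,
      show (1 - R⁻¹) • x₀ + R⁻¹ • x - x₀ = R⁻¹ • (x - x₀) by
        rw [sub_smul, one_smul, smul_sub]; abel, norm_smul, norm_inv,
      Real.norm_of_nonneg hR0.le, inv_mul_le_iff₀ hR0]
    rw [hR]; linarith
  have h1 := isMinOn_iff.1 hmin _ hball
  rw [← hf.coe_toReal hd, ← hf.coe_toReal hpd, EReal.coe_le_coe_iff] at h1
  simp only [smul_eq_mul] at hc
  have h2 : R * (f p).toReal ≤ (R - 1) * (f x₀).toReal + (f x).toReal := by
    have := mul_le_mul_of_nonneg_left (h1.trans hc) hR0.le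
    have e : R * ((1 - R⁻¹) * (f x₀).toReal + R⁻¹ * (f x).toReal) =
        (R - 1) * (f x₀).toReal + (f x).toReal := by
      field_simp
    linarith
  have h3 := neg_abs_le (f p).toReal
  have h4 := le_abs_self (f x₀).toReal
  have h5 : R ≤ 1 + ‖x‖ + ‖x₀‖ := by rw [hR]; linarith [norm_sub_le x x₀]
  have h6 : (1 + ‖x‖ + ‖x₀‖) ≤ (1 + ‖x₀‖) * (1 + ‖x‖) := by
    nlinarith [norm_nonneg x, norm_nonneg x₀]
  have h7 : M * R ≤ M * ((1 + ‖x₀‖) * (1 + ‖x‖)) := mul_le_mul_of_nonneg_left (h5.trans h6) hM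
  have h8 : 1 ≤ R := by rw [hR]; linarith [norm_nonneg (x - x₀)]
  have h9 : (R - 1) * (f x₀).toReal ≤ R * |(f x₀).toReal| := by
    nlinarith [abs_nonneg (f x₀).toReal]
  have h10 : -(R * |(f p).toReal|) ≤ R * (f p).toReal := by nlinarith
  have h11 : M * R = R * |(f p).toReal| + R * |(f x₀).toReal| := by simp only [M]; ring
  linarith

theorem lowerSemicontinuous_ereal_add {X : Type*} [TopologicalSpace X] {g k : X → EReal}
    (hg : LowerSemicontinuous g) (hk : LowerSemicontinuous k) (hg' : ∀ x, g x ≠ ⊥)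
    (hk' : ∀ x, k x ≠ ⊥) : LowerSemicontinuous fun x => g x + k x :=
  LowerSemicontinuous.add' hg hk fun x =>
    EReal.continuousAt_add (Or.inr (hk' x)) (Or.inl (hg' x))

theorem ereal_sum_ne_bot {ι : Type*} (s : Finset ι) {g : ι → EReal} (hg : ∀ i, g i ≠ ⊥) :
    ∑ i ∈ s, g i ≠ ⊥ := by
  classical
  induction s using Finset.induction_on with
  | empty => simp
  | insert a s ha ih =>
    rw [Finset.sum_insert ha]
    exact EReal.add_ne_bot_iff.2 ⟨hg a, ih⟩

theorem ereal_sum_coe {ι : Type*} (s : Finset ι) (g : ι → ℝ) :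
    ∑ i ∈ s, (g i : EReal) = ((∑ i ∈ s, g i : ℝ) : EReal) := by
  classical
  induction s using Finset.induction_on with
  | empty => simp
  | insert a s ha ih => rw [Finset.sum_insert ha, Finset.sum_insert ha, ih, EReal.coe_add]

theorem ereal_sum_lt_top {ι : Type*} {s : Finset ι} {g : ι → EReal} (hg : ∀ i, g i ≠ ⊥)
    (hs : ∑ i ∈ s, g i < ⊤) {i : ι} (hi : i ∈ s) : g i < ⊤ := by
  classical
  rw [← Finset.add_sum_erase s g hi] at hs
  by_contra h
  rw [not_lt_top_iff] at h
  rw [h, EReal.top_add_of_ne_bot (ereal_sum_ne_bot _ hg)] at hs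
  exact hs.false

theorem lowerSemicontinuous_ereal_sum {X ι : Type*} [TopologicalSpace X] (s : Finset ι)
    {g : ι → X → EReal} (hg : ∀ i, LowerSemicontinuous (g i)) (hg' : ∀ i x, g i x ≠ ⊥) :
    LowerSemicontinuous fun x => ∑ i ∈ s, g i x := by
  classical
  induction s using Finset.induction_on with
  | empty => simpa using lowerSemicontinuous_const
  | insert a s ha ih =>
    simp only [Finset.sum_insert ha]
    exact lowerSemicontinuous_ereal_add (hg a) ih (hg' a)
      fun x => ereal_sum_ne_bot _ fun i => hg' i x

theorem IsClosedProperConvex.isProxPoint_prox [ProperSpace E] (hf : IsClosedProperConvex f)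
    (θ : E) : IsProxPoint f θ (prox f θ) := by
  obtain ⟨K, hK, hb⟩ := hf.exists_linear_lower_bound
  obtain ⟨x₀, hx₀⟩ := hf.domain_nonempty
  have hlsc : LowerSemicontinuous fun δ => f δ + ((1 / 2 * ‖δ - θ‖ ^ 2 : ℝ) : EReal) := by
    refine lowerSemicontinuous_ereal_add hf.lsc (Continuous.lowerSemicontinuous ?_) hf.ne_bot
      fun _ => EReal.coe_ne_bot _
    exact continuous_coe_real_ereal.comp (by fun_prop)
  obtain ⟨p, -, hp⟩ := exists_forall_le_of_quadratic_growth hlsc isClosed_univ (mem_univ x₀)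
    (EReal.add_lt_top (ne_of_lt hx₀) (EReal.coe_ne_top _)) (a := 1 / 4)
    (b := (‖θ‖ + K) ^ 2 + K) (by norm_num) (fun x => by
      refine le_trans ?_ (add_le_add (hb x) le_rfl)
      rw [← EReal.coe_add, EReal.coe_le_coe_iff]
      have h1 : ‖x‖ - ‖θ‖ ≤ ‖x - θ‖ := norm_sub_norm_le x θ
      have h2 : (‖x‖ - ‖θ‖) ^ 2 ≤ ‖x - θ‖ ^ 2 :=
        sq_le_sq' (by linarith [norm_sub_norm_le θ x, norm_sub_rev x θ]) h1
      nlinarith [sq_nonneg (1 / 2 * ‖x‖ - (‖θ‖ + K)), sq_nonneg ‖θ‖])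
  exact Classical.epsilon_spec (p := IsProxPoint f θ) ⟨p, fun δ => hp δ (mem_univ δ)⟩

/-- Compare the minimiser with the point at parameter `t` on the segment to `δ`, divide by `t` and
let `t` tend to zero. -/
theorem IsClosedProperConvex.isSubgradientAt_prox [ProperSpace E] (hf : IsClosedProperConvex f)
    (θ : E) : IsSubgradientAt f (θ - prox f θ) (prox f θ) := by
  set p := prox f θ with hp_def
  have hp : IsProxPoint f θ p := hf.isProxPoint_prox θ
  have hpd : p ∈ effDomain f := by
    obtain ⟨x₀, hx₀⟩ := hf.domain_nonempty
    have h1 := (hp x₀).trans_lt (EReal.add_lt_top (ne_of_lt hx₀) (EReal.coe_ne_top _))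
    by_contra h
    have h2 : f p = ⊤ := by simpa [effDomain] using h
    rw [h2, EReal.top_add_coe] at h1
    exact h1.false
  have hreal : ∀ δ ∈ effDomain f, (f p).toReal + 1 / 2 * ‖p - θ‖ ^ 2 ≤
      (f δ).toReal + 1 / 2 * ‖δ - θ‖ ^ 2 := fun δ hδ => by
    have h1 := hp δ
    rwa [← hf.coe_toReal hpd, ← hf.coe_toReal hδ, ← EReal.coe_add, ← EReal.coe_add,
      EReal.coe_le_coe_iff] at h1
  refine ⟨hpd, fun δ hδ => ?_⟩
  have key : ∀ t ∈ Ioc (0 : ℝ) 1,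
      0 ≤ (f δ).toReal - (f p).toReal - inner ℝ (θ - p) (δ - p) + t * (1 / 2 * ‖δ - p‖ ^ 2) := by
    intro t ht
    have hd := hf.convexOn.1 hpd hδ (sub_nonneg.2 ht.2) ht.1.le (by ring)
    have hc := hf.convexOn.2 hpd hδ (sub_nonneg.2 ht.2) ht.1.le (by ring)
    have h1 := hreal _ hd
    have e : (1 - t) • p + t • δ - θ = (p - θ) + t • (δ - p) := by
      rw [sub_smul, one_smul, smul_sub]; abel
    rw [e, norm_add_sq_real, inner_smul_right, norm_smul, Real.norm_of_nonneg ht.1.le] at h1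
    simp only [smul_eq_mul] at hc
    have e2 : inner ℝ (p - θ) (δ - p) = - inner ℝ (θ - p) (δ - p) := by
      rw [← inner_neg_left, neg_sub]
    rw [e2] at h1
    have h2 : 0 ≤ t * ((f δ).toReal - (f p).toReal - inner ℝ (θ - p) (δ - p)
        + t * (1 / 2 * ‖δ - p‖ ^ 2)) := by nlinarith
    exact nonneg_of_mul_nonneg_right h2 ht.1
  have hlim : Tendsto (fun t : ℝ => (f δ).toReal - (f p).toReal - inner ℝ (θ - p) (δ - p)
      + t * (1 / 2 * ‖δ - p‖ ^ 2)) (𝓝[>] 0)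
      (𝓝 ((f δ).toReal - (f p).toReal - inner ℝ (θ - p) (δ - p) + 0 * (1 / 2 * ‖δ - p‖ ^ 2))) := by
    refine Tendsto.mono_left (Continuous.tendsto ?_ 0) nhdsWithin_le_nhds
    fun_prop
  have := ge_of_tendsto hlim (by
    filter_upwards [Ioc_mem_nhdsGT (zero_lt_one' ℝ)] with t ht using key t ht)
  linarith

theorem IsClosedProperConvex.norm_prox_sub_le [ProperSpace E] (hf : IsClosedProperConvex f)
    (θ θ' : E) : ‖prox f θ - prox f θ'‖ ≤ ‖θ - θ'‖ := by
  have h1 := (hf.isSubgradientAt_prox θ).monotone (hf.isSubgradientAt_prox θ')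
  rw [sub_sub_sub_comm, inner_sub_left, real_inner_self_eq_norm_sq] at h1
  have h2 := real_inner_le_norm (θ - θ') (prox f θ - prox f θ')
  by_contra! h
  nlinarith [norm_nonneg (θ - θ'), norm_nonneg (prox f θ - prox f θ')]

/-- The convex conjugate of `f + ‖·‖² / 2`, a primitive of the proximal operator. -/
def proxPotential (f : E → EReal) (θ : E) : ℝ :=
  inner ℝ θ (prox f θ) - 1 / 2 * ‖prox f θ‖ ^ 2 - (f (prox f θ)).toReal

/-- The Fenchel–Young inequality: the supremum defining the conjugate is attained at the proximal
point. -/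
theorem IsClosedProperConvex.le_proxPotential [ProperSpace E] (hf : IsClosedProperConvex f)
    (θ : E) {w : E} (hw : w ∈ effDomain f) :
    inner ℝ θ w - 1 / 2 * ‖w‖ ^ 2 - (f w).toReal ≤ proxPotential f θ := by
  have h1 := (hf.isSubgradientAt_prox θ).2 w hw
  unfold proxPotential
  set p := prox f θ
  have h2 : 0 ≤ ‖w - p‖ ^ 2 := sq_nonneg _
  rw [norm_sub_sq_real] at h2
  simp only [inner_sub_left, inner_sub_right, real_inner_self_eq_norm_sq] at h1
  rw [real_inner_comm] at h2
  linarith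

theorem IsClosedProperConvex.hasFDerivAt_proxPotential [ProperSpace E]
    (hf : IsClosedProperConvex f) (θ : E) :
    HasFDerivAt (proxPotential f) (innerSL ℝ (prox f θ)) θ := by
  rw [hasFDerivAt_iff_isLittleO]
  refine Asymptotics.IsBigO.trans_isLittleO (g := fun θ' => ‖θ' - θ‖ ^ 2) ?_ ?_
  · refine Asymptotics.IsBigO.of_bound 1 (Eventually.of_forall fun θ' => ?_)
    -- `prox f a` is a subgradient of the potential at `a`. Used in both directions, this squeezes
    -- the remainder between zero and `⟨prox f θ' - prox f θ, θ' - θ⟩`, which is quadratic by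
    -- nonexpansiveness.
    have hlow : ∀ a b : E, proxPotential f a + inner ℝ (prox f a) (b - a) ≤ proxPotential f b := by
      intro a b
      have h1 := hf.le_proxPotential b (hf.isSubgradientAt_prox a).1
      have h2 : inner ℝ (prox f a) (b - a) = inner ℝ b (prox f a) - inner ℝ a (prox f a) := by
        rw [inner_sub_right, real_inner_comm, real_inner_comm a]
      rw [h2]
      unfold proxPotential at h1 ⊢
      linarith
    have h1 := hlow θ θ'
    have h2 := hlow θ' θ
    have h3 : inner ℝ (prox f θ') (θ - θ') = - inner ℝ (prox f θ') (θ' - θ) := by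
      rw [← inner_neg_right, neg_sub]
    have h4 : inner ℝ (prox f θ' - prox f θ) (θ' - θ) ≤ ‖θ' - θ‖ ^ 2 := by
      refine (real_inner_le_norm _ _).trans ?_
      rw [pow_two]
      exact mul_le_mul_of_nonneg_right (hf.norm_prox_sub_le _ _) (norm_nonneg _)
    rw [inner_sub_left] at h4
    simp only [innerSL_apply_apply, Real.norm_eq_abs, abs_pow, abs_norm, one_mul]
    rw [abs_le]
    constructor
    · nlinarith [sq_nonneg ‖θ' - θ‖]
    · linarith
  · have := Asymptotics.isLittleO_pow_sub_sub (E' := E) (x₀ := θ) (m := 2) one_lt_two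
    simpa using this

end Convex

/-! ### Lagrange multipliers -/

section Multipliers

/-- A Lagrange multiplier rule: if `xs` minimises the convex function `g` on `D ∩ (xs + S)`, and
`xs + S` meets the algebraic relative interior of `D`, then `g` has a subgradient at `xs` which
vanishes on `S`. -/
theorem exists_subgradient_of_forall_le {W : Type*} [AddCommGroup W] [Module ℝ W] {D : Set W}
    {g : W → ℝ} (hg : ConvexOn ℝ D g) (S : Submodule ℝ W) {xs y : W} (hxs : xs ∈ D)
    (hmin : ∀ s ∈ S, xs + s ∈ D → g xs ≤ g (xs + s)) (hyS : y - xs ∈ S) (hyD : y ∈ D)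
    (hy : ∀ x ∈ D, ∃ ε : ℝ, 0 < ε ∧ y - ε • (x - y) ∈ D) :
    ∃ u : W →ₗ[ℝ] ℝ, (∀ s ∈ S, u s = 0) ∧ ∀ x ∈ D, g xs + u (x - xs) ≤ g x := by
  have hneg : ∀ w : W, (∃ ε : ℝ, 0 < ε ∧ y + ε • w ∈ D) → ∃ ε : ℝ, 0 < ε ∧ y + ε • (-w) ∈ D := by
    rintro w ⟨ε, hε, hw⟩
    obtain ⟨ε', hε', hw'⟩ := hy _ hw
    refine ⟨ε' * ε, mul_pos hε' hε, ?_⟩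
    rwa [add_sub_cancel_left, smul_smul, sub_eq_add_neg, ← smul_neg] at hw'
  have hsmul : ∀ (c : ℝ) (w : W), 0 < c → (∃ ε : ℝ, 0 < ε ∧ y + ε • w ∈ D) →
      ∃ ε : ℝ, 0 < ε ∧ y + ε • (c • w) ∈ D := by
    rintro c w hc ⟨ε, hε, hw⟩
    refine ⟨ε / c, div_pos hε hc, ?_⟩
    rwa [smul_smul, div_mul_cancel₀ _ hc.ne']
  -- Relative interiority makes the cone of directions from `y` into `D` a linear subspace.
  let T : Submodule ℝ W :=
    { carrier := {w | ∃ ε : ℝ, 0 < ε ∧ y + ε • w ∈ D}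
      zero_mem' := ⟨1, one_pos, by simpa using hyD⟩
      add_mem' := by
        rintro w w' ⟨ε, hε, hw⟩ ⟨ε', hε', hw'⟩
        have hs : 0 < ε + ε' := add_pos hε hε'
        refine ⟨ε * ε' / (ε + ε'), by positivity, ?_⟩
        have h1 := hg.1 hw hw' (show 0 ≤ ε' / (ε + ε') by positivity)
          (show 0 ≤ ε / (ε + ε') by positivity) (by field_simp; ring)
        convert h1 using 1
        have e1 : ε' / (ε + ε') + ε / (ε + ε') = 1 := by field_simp; ring
        calc y + (ε * ε' / (ε + ε')) • (w + w')
            = (ε' / (ε + ε') + ε / (ε + ε')) • y + (ε * ε' / (ε + ε')) • (w + w') := by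
              rw [e1, one_smul]
          _ = _ := by module
      smul_mem' := by
        intro c w hw
        rcases lt_trichotomy c 0 with hc | hc | hc
        · have := hsmul (-c) _ (by linarith) (hneg w hw)
          simpa using this
        · rw [hc, zero_smul]
          exact ⟨1, one_pos, by simpa using hyD⟩
        · exact hsmul c w hc hw }
  have hTD : ∀ x ∈ D, x - y ∈ T := fun x hx => ⟨1, one_pos, by simpa using hx⟩
  -- A linear projection onto `T ⊔ S`. Defining the cone below through `P k.1` makes the domination
  -- condition of `riesz_extension` attainable on all of `W`, even if `T ⊔ S` is a proper subspace.
  obtain ⟨P, hP⟩ := (T ⊔ S).subtype.exists_leftInverse_of_injective (Submodule.ker_subtype _)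
  have hPid : ∀ w ∈ T ⊔ S, (P w : W) = w := fun w hw =>
    congrArg Subtype.val (LinearMap.congr_fun hP ⟨w, hw⟩)
  have hDmem : ∀ x ∈ D, x - xs ∈ T ⊔ S := fun x hx => by
    rw [← sub_add_sub_cancel x y xs]
    exact Submodule.add_mem_sup (hTD x hx) hyS
  -- The cone generated by the epigraph of `g` seen from `(xs, g xs)`, pulled back along `P`. By
  -- minimality the functional `(s, ρ) ↦ ρ` on `S × ℝ` is nonnegative on it; a positive extension
  -- `ψ` gives the multiplier `-ψ (·, 0)`.
  let K : PointedCone ℝ (W × ℝ) :=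
    { carrier := {k | ∃ x ∈ D, ∃ t : ℝ, 0 ≤ t ∧ (P k.1 : W) = t • (x - xs) ∧
        t * (g x - g xs) ≤ k.2}
      zero_mem' := ⟨xs, hxs, 0, le_rfl, by simp, by simp⟩
      add_mem' := by
        rintro k k' ⟨x, hx, t, ht, h1, h2⟩ ⟨x', hx', t', ht', h1', h2'⟩
        rcases (add_nonneg ht ht').eq_or_lt with h0 | h0
        · have ht0 : t = 0 := by linarith
          have ht0' : t' = 0 := by linarith
          refine ⟨xs, hxs, 0, le_rfl, ?_, ?_⟩
          · simp [h1, h1', ht0, ht0']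
          · simp only [ht0, ht0', zero_mul] at h2 h2'
            simpa using add_nonneg h2 h2'
        · have hd := hg.1 hx hx' (show 0 ≤ t / (t + t') by positivity)
            (show 0 ≤ t' / (t + t') by positivity) (by field_simp)
          have hc := hg.2 hx hx' (show 0 ≤ t / (t + t') by positivity)
            (show 0 ≤ t' / (t + t') by positivity) (by field_simp)
          have e1 : (t + t') * (t / (t + t')) = t := by field_simp
          have e2 : (t + t') * (t' / (t + t')) = t' := by field_simp
          refine ⟨_, hd, t + t', h0.le, ?_, ?_⟩
          · rw [Prod.fst_add, map_add, Submodule.coe_add, h1, h1']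
            calc t • (x - xs) + t' • (x' - xs)
                = t • x + t' • x' - (t + t') • xs := by module
              _ = ((t + t') * (t / (t + t'))) • x + ((t + t') * (t' / (t + t'))) • x'
                  - (t + t') • xs := by rw [e1, e2]
              _ = _ := by module
          · simp only [smul_eq_mul] at hc
            have h3 := mul_le_mul_of_nonneg_left hc h0.le
            rw [mul_add, ← mul_assoc, ← mul_assoc, e1, e2] at h3
            rw [Prod.snd_add, mul_sub]
            linarith
      smul_mem' := by
        rintro ⟨c, hc⟩ k ⟨x, hx, t, ht, h1, h2⟩
        refine ⟨x, hx, c * t, mul_nonneg hc ht, ?_, ?_⟩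
        · change (P (c • k.1) : W) = _
          rw [map_smul, Submodule.coe_smul, h1, smul_smul]
        · change c * t * _ ≤ c * k.2
          rw [mul_assoc]
          exact mul_le_mul_of_nonneg_left h2 hc }
  let φ : (W × ℝ) →ₗ.[ℝ] ℝ :=
    { domain := S.prod ⊤
      toFun := (LinearMap.snd ℝ W ℝ).comp (S.prod ⊤).subtype }
  obtain ⟨ψ, hψ, hψK⟩ := riesz_extension K φ
    (by
      rintro ⟨⟨s, ρ⟩, hs⟩ ⟨x, hx, t, ht, h1, h2⟩
      have hsS : s ∈ S := hs.1
      change (P s : W) = _ at h1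
      change t * _ ≤ ρ at h2
      change 0 ≤ ρ
      rw [hPid s (Submodule.mem_sup_right hsS)] at h1
      rcases ht.eq_or_lt with h0 | h0
      · rw [← h0, zero_mul] at h2
        exact h2
      · have hx' : x = xs + t⁻¹ • s := by
          rw [h1, smul_smul, inv_mul_cancel₀ h0.ne', one_smul, add_sub_cancel]
        have h3 := hmin (t⁻¹ • s) (S.smul_mem _ hsS) (hx' ▸ hx)
        rw [← hx'] at h3
        exact le_trans (mul_nonneg ht (sub_nonneg.2 h3)) h2)
    (by
      rintro ⟨w, σ⟩
      obtain ⟨τ, ⟨ε, hε, hτ⟩, s', hs', hsum⟩ := Submodule.mem_sup.1 (P w).2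
      -- This shift removes `s'` and moves the base point from `y` to `xs`: the projected sum
      -- becomes `ε⁻¹ • (y + ε • τ - xs)`.
      have hsS : -s' + ε⁻¹ • (y - xs) ∈ S := S.add_mem (S.neg_mem hs') (S.smul_mem _ hyS)
      refine ⟨⟨(-s' + ε⁻¹ • (y - xs), ε⁻¹ * (g (y + ε • τ) - g xs) - σ), hsS, trivial⟩,
        y + ε • τ, hτ, ε⁻¹, by positivity, ?_, ?_⟩
      · change (P (-s' + ε⁻¹ • (y - xs) + w) : W) = _
        rw [map_add, Submodule.coe_add, hPid _ (Submodule.mem_sup_right hsS), ← hsum]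
        have : τ = ε⁻¹ • ε • τ := by rw [smul_smul, inv_mul_cancel₀ hε.ne', one_smul]
        rw [show y + ε • τ - xs = (y - xs) + ε • τ by abel, smul_add, ← this]
        abel
      · change _ ≤ ε⁻¹ * (g (y + ε • τ) - g xs) - σ + σ
        linarith)
  refine ⟨-(ψ.comp (LinearMap.inl ℝ W ℝ)), fun s hs => ?_, fun x hx => ?_⟩
  · have := hψ ⟨(s, 0), hs, trivial⟩
    change -(ψ (s, 0)) = 0
    rw [this]
    exact neg_zero
  · have h1 : 0 ≤ ψ (x - xs, g x - g xs) := hψK _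
      ⟨x, hx, 1, zero_le_one, by rw [hPid _ (hDmem x hx), one_smul], by simp⟩
    have h2 : ψ (0, g x - g xs) = g x - g xs := hψ ⟨(0, g x - g xs), S.zero_mem, trivial⟩
    have h3 : ψ (x - xs, g x - g xs) = ψ (x - xs, 0) + ψ (0, g x - g xs) := by
      rw [← map_add]; simp
    change g xs + -(ψ (x - xs, 0)) ≤ g x
    linarith

/-- The line through `x` and `y` stays in the affine span, in which `y` is interior. The eventual
form allows one `ε` to serve finitely many sets. -/
theorem eventually_sub_smul_mem_of_mem_intrinsicInterior {E : Type*} [NormedAddCommGroup E]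
    [NormedSpace ℝ E] {s : Set E} {x y : E} (hy : y ∈ intrinsicInterior ℝ s) (hx : x ∈ s) :
    ∀ᶠ ε in 𝓝 (0 : ℝ), y - ε • (x - y) ∈ s := by
  obtain ⟨y', hy', rfl⟩ := mem_intrinsicInterior.1 hy
  have hmem : ∀ t : ℝ, AffineMap.lineMap (y' : E) x (-t) ∈ affineSpan ℝ s := fun t =>
    AffineMap.lineMap_mem _ y'.2 (subset_affineSpan ℝ s hx)
  let c : ℝ → affineSpan ℝ s := fun t => ⟨AffineMap.lineMap (y' : E) x (-t), hmem t⟩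
  have hc : Continuous c := by
    refine Continuous.subtype_mk ?_ _
    simp only [AffineMap.lineMap_apply_module']
    fun_prop
  have hc0 : c 0 = y' := by
    apply Subtype.ext
    simp [c]
  have h1 : ∀ᶠ t in 𝓝 (0 : ℝ), c t ∈ interior ((↑) ⁻¹' s : Set (affineSpan ℝ s)) := by
    refine hc.tendsto 0 (isOpen_interior.mem_nhds ?_)
    rw [hc0]
    exact hy'
  filter_upwards [h1] with t ht
  have h2 : c t ∈ ((↑) ⁻¹' s : Set (affineSpan ℝ s)) := interior_subset ht
  change (c t : E) ∈ s at h2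
  simp only [c, AffineMap.lineMap_apply_module', neg_smul] at h2
  rwa [neg_add_eq_sub] at h2

end Multipliers

/-! ### Strongly monotone gradients -/

section StrongConvexity

variable {E : Type*} [NormedAddCommGroup E] [InnerProductSpace ℝ E] [CompleteSpace E] {φ : E → ℝ}

theorem hasDerivAt_comp_add_smul (hφ : Differentiable ℝ φ) (a s : E) (t : ℝ) :
    HasDerivAt (fun t : ℝ => φ (a + t • s)) (inner ℝ (∇ φ (a + t • s)) s) t := by
  have h1 : HasDerivAt (fun t : ℝ => a + t • s) s t := by
    simpa using ((hasDerivAt_id t).smul_const s).const_add a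
  have h2 := (hφ (a + t • s)).hasGradientAt.hasFDerivAt
  exact (h2.comp_hasDerivAt t h1).congr_deriv (by simp)

/-- Along the segment, `φ` minus its linearisation and minus the quadratic term has a nonnegative
derivative. -/
theorem quadratic_lower_bound (hφ : Differentiable ℝ φ) {c : ℝ}
    (hc : ∀ a b, c * ‖a - b‖ ^ 2 ≤ inner ℝ (∇ φ a - ∇ φ b) (a - b)) (a b : E) :
    φ a + inner ℝ (∇ φ a) (b - a) + c / 2 * ‖b - a‖ ^ 2 ≤ φ b := by
  set s := b - a
  have hd : ∀ t : ℝ, HasDerivAt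
      (fun t : ℝ => φ (a + t • s) - t * inner ℝ (∇ φ a) s - t ^ 2 * (c / 2 * ‖s‖ ^ 2))
      (inner ℝ (∇ φ (a + t • s)) s - inner ℝ (∇ φ a) s - 2 * t * (c / 2 * ‖s‖ ^ 2)) t := by
    intro t
    have h1 := hasDerivAt_comp_add_smul hφ a s t
    have h2 := (hasDerivAt_id t).mul_const (inner ℝ (∇ φ a) s)
    have h3 := (hasDerivAt_pow 2 t).mul_const (c / 2 * ‖s‖ ^ 2)
    exact ((h1.fun_sub h2).fun_sub h3).congr_deriv (by simp)
  have hmono : MonotoneOn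
      (fun t : ℝ => φ (a + t • s) - t * inner ℝ (∇ φ a) s - t ^ 2 * (c / 2 * ‖s‖ ^ 2))
      (Icc 0 1) := by
    refine monotoneOn_of_deriv_nonneg (convex_Icc 0 1)
      (fun t _ => (hd t).continuousAt.continuousWithinAt)
      (fun t _ => (hd t).differentiableAt.differentiableWithinAt) fun t ht => ?_
    rw [interior_Icc] at ht
    rw [(hd t).deriv]
    have h1 := hc (a + t • s) a
    rw [add_sub_cancel_left, norm_smul, inner_smul_right, inner_sub_left, mul_pow,
      Real.norm_eq_abs, sq_abs] at h1
    have h2 : t * (t * (c * ‖s‖ ^ 2)) ≤ t * (inner ℝ (∇ φ (a + t • s)) s - inner ℝ (∇ φ a) s) := by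
      linarith
    have h3 := le_of_mul_le_mul_left h2 ht.1
    linarith
  have h := hmono (left_mem_Icc.2 zero_le_one) (right_mem_Icc.2 zero_le_one) zero_le_one
  have e : a + (1 : ℝ) • s = b := by rw [one_smul]; exact add_sub_cancel a b
  simp only [e] at h
  simp only [zero_smul, add_zero, zero_mul, sub_zero, one_mul, one_pow, zero_pow two_ne_zero] at h
  linarith

end StrongConvexity

/-! ### Optimality conditions for the resource allocation problem -/

section Optimality

variable {n q r : ℕ} {f0 : Fin n → EuclideanSpace ℝ (Fin q) → ℝ}
  {f : Fin n → Fin (r + 1) → EuclideanSpace ℝ (Fin q) → EReal}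
  {d : Fin n → EuclideanSpace ℝ (Fin q)}

/-- The real-valued cost, which agrees with `globalCost` on the effective domain. -/
def realCost (f0 : Fin n → EuclideanSpace ℝ (Fin q) → ℝ)
    (f : Fin n → Fin (r + 1) → EuclideanSpace ℝ (Fin q) → EReal)
    (x : Fin n → EuclideanSpace ℝ (Fin q)) : ℝ :=
  ∑ i, (f0 i (x i) + ∑ j, (f i j (x i)).toReal)

theorem globalCost_eq_realCost (hf : ∀ i j, IsClosedProperConvex (f i j))
    {x : Fin n → EuclideanSpace ℝ (Fin q)} (hx : ∀ i j, x i ∈ effDomain (f i j)) :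
    globalCost f0 f x = realCost f0 f x := by
  rw [globalCost, realCost, ← ereal_sum_coe]
  refine Finset.sum_congr rfl fun i _ => ?_
  rw [EReal.coe_add, ← ereal_sum_coe]
  congr 1
  exact Finset.sum_congr rfl fun j _ => ((hf i j).coe_toReal (hx i j)).symm

theorem mem_effDomain_of_globalCost_lt_top (hf : ∀ i j, IsClosedProperConvex (f i j))
    {x : Fin n → EuclideanSpace ℝ (Fin q)} (hx : globalCost f0 f x < ⊤) (i : Fin n)
    (j : Fin (r + 1)) : x i ∈ effDomain (f i j) := by
  have hs : ∀ i, ∑ j, f i j (x i) ≠ ⊥ := fun i => ereal_sum_ne_bot _ fun j => (hf i j).ne_bot _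
  have h1 := ereal_sum_lt_top (fun i => EReal.add_ne_bot_iff.2 ⟨EReal.coe_ne_bot _, hs i⟩) hx
    (Finset.mem_univ i)
  have h2 : ∑ j, f i j (x i) < ⊤ := by
    by_contra h
    rw [not_lt_top_iff] at h
    rw [h, EReal.coe_add_top] at h1
    exact h1.false
  exact ereal_sum_lt_top (fun j => (hf i j).ne_bot _) h2 (Finset.mem_univ j)

theorem exists_isSolution (hf0 : ∀ i, ContDiff ℝ 2 (f0 i)) {c : ℝ} (hc0 : 0 < c)
    (hf0c : ∀ i a b, c * ‖a - b‖ ^ 2 ≤ inner ℝ (∇ (f0 i) a - ∇ (f0 i) b) (a - b))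
    (hf : ∀ i j, IsClosedProperConvex (f i j))
    (hfeas : ∃ y : Fin n → EuclideanSpace ℝ (Fin q), ∑ i, y i = ∑ i, d i ∧
      ∀ i j, y i ∈ effDomain (f i j)) : ∃ xs, IsSolution f0 f d xs := by
  obtain ⟨y, hy, hyd⟩ := hfeas
  have hylt : globalCost f0 f y < ⊤ := by
    rw [globalCost_eq_realCost hf hyd]
    exact EReal.coe_lt_top _
  have hlsc : LowerSemicontinuous (globalCost f0 f) := by
    refine lowerSemicontinuous_ereal_sum _ (fun i => ?_) fun i x =>
      EReal.add_ne_bot_iff.2 ⟨EReal.coe_ne_bot _, ereal_sum_ne_bot _ fun j => (hf i j).ne_bot _⟩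
    refine lowerSemicontinuous_ereal_add (Continuous.lowerSemicontinuous ?_)
      (lowerSemicontinuous_ereal_sum _ (fun j => ?_) fun j x => (hf i j).ne_bot _)
      (fun x => EReal.coe_ne_bot _) fun x => ereal_sum_ne_bot _ fun j => (hf i j).ne_bot _
    · exact continuous_coe_real_ereal.comp ((hf0 i).continuous.comp (continuous_apply i))
    · exact (hf i j).lsc.comp (continuous_apply i)
  have hcl : IsClosed {x : Fin n → EuclideanSpace ℝ (Fin q) | ∑ i, x i = ∑ i, d i} :=
    isClosed_eq (by fun_prop) continuous_const
  choose K hK0 hK using fun i j => (hf i j).exists_linear_lower_bound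
  -- `B i` is the linear rate at which the gradient at zero and the nonsmooth terms can lower the
  -- cost. Half of the coefficient `c / 2` absorbs it, and completing the square costs `B i ^ 2 /
  -- c`.
  set B : Fin n → ℝ := fun i => ‖∇ (f0 i) 0‖ + ∑ j, K i j
  set C : Fin n → ℝ := fun i => (B i) ^ 2 / c + ∑ j, K i j - f0 i 0
  have hterm : ∀ i (x : EuclideanSpace ℝ (Fin q)), c / 4 * ‖x‖ ^ 2 - C i ≤
      f0 i x + ∑ j, -(K i j * (1 + ‖x‖)) := by
    intro i x
    have h1 := quadratic_lower_bound ((hf0 i).differentiable two_ne_zero) (hf0c i) 0 x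
    simp only [sub_zero] at h1
    have h2 : -(‖∇ (f0 i) 0‖ * ‖x‖) ≤ inner ℝ (∇ (f0 i) 0) x :=
      (abs_le.1 (abs_real_inner_le_norm _ _)).1
    have h3 : ∑ j, -(K i j * (1 + ‖x‖)) = -((∑ j, K i j) * (1 + ‖x‖)) := by
      rw [Finset.sum_neg_distrib, Finset.sum_mul]
    rw [h3]
    have h4 : c / 4 * ‖x‖ ^ 2 - B i * ‖x‖ + (B i) ^ 2 / c = c * (1 / 2 * ‖x‖ - B i / c) ^ 2 := by
      field_simp
      ring
    have h5 : 0 ≤ c * (1 / 2 * ‖x‖ - B i / c) ^ 2 := by positivity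
    have h6 : B i * ‖x‖ = ‖∇ (f0 i) 0‖ * ‖x‖ + (∑ j, K i j) * ‖x‖ := add_mul _ _ _
    simp only [C]
    linarith
  obtain ⟨xs, hxs, hmin⟩ := exists_forall_le_of_quadratic_growth hlsc hcl hy hylt
    (a := c / 4) (b := ∑ i, C i) (by positivity) (fun x => by
      have h1 : ((∑ i, (f0 i (x i) + ∑ j, -(K i j * (1 + ‖x i‖))) : ℝ) : EReal) ≤
          globalCost f0 f x := by
        rw [← ereal_sum_coe]
        refine Finset.sum_le_sum fun i _ => ?_
        rw [EReal.coe_add, ← ereal_sum_coe]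
        gcongr with j
        exact hK i j _
      refine le_trans ?_ h1
      rw [EReal.coe_le_coe_iff]
      have h2 := Finset.sum_le_sum fun i (_ : i ∈ Finset.univ) => hterm i (x i)
      refine le_trans ?_ h2
      rw [Finset.sum_sub_distrib _ C, ← Finset.mul_sum]
      have h3 : ‖x‖ ^ 2 ≤ ∑ i, ‖x i‖ ^ 2 := by
        have hnn : 0 ≤ ∑ i, ‖x i‖ ^ 2 := Finset.sum_nonneg fun i _ => sq_nonneg _
        rw [← Real.le_sqrt (norm_nonneg _) hnn]
        refine (pi_norm_le_iff_of_nonneg (Real.sqrt_nonneg _)).2 fun i => ?_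
        rw [Real.le_sqrt (norm_nonneg _) hnn]
        exact Finset.single_le_sum (f := fun i => ‖x i‖ ^ 2) (fun i _ => sq_nonneg _)
          (Finset.mem_univ i)
      nlinarith)
  exact ⟨xs, ⟨hxs, (hmin y hy).trans_lt hylt⟩, hmin⟩

/-- The KKT conditions: `xs` is feasible, and all agents share the multiplier `lam`. -/
structure IsKKT (f0 : Fin n → EuclideanSpace ℝ (Fin q) → ℝ)
    (f : Fin n → Fin (r + 1) → EuclideanSpace ℝ (Fin q) → EReal)
    (d xs : Fin n → EuclideanSpace ℝ (Fin q)) (lam : EuclideanSpace ℝ (Fin q))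
    (us : Fin n → Fin (r + 1) → EuclideanSpace ℝ (Fin q)) : Prop where
  sum_eq : ∑ i, xs i = ∑ i, d i
  subgradient : ∀ i j, IsSubgradientAt (f i j) (us i j) (xs i)
  stationary : ∀ i, ∇ (f0 i) (xs i) + ∑ j, us i j = lam

/-- The multiplier terms sum to `⟨lam, ∑ (x - xs)⟩ = 0` by feasibility, so strong convexity leaves
an excess cost of `c / 2 * ∑ ‖x - xs‖ ^ 2`, which minimality of `x` forbids. -/
theorem IsKKT.eq_of_isSolution (hf0 : ∀ i, ContDiff ℝ 2 (f0 i)) {c : ℝ} (hc0 : 0 < c)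
    (hf0c : ∀ i a b, c * ‖a - b‖ ^ 2 ≤ inner ℝ (∇ (f0 i) a - ∇ (f0 i) b) (a - b))
    (hf : ∀ i j, IsClosedProperConvex (f i j)) {xs x : Fin n → EuclideanSpace ℝ (Fin q)}
    {lam : EuclideanSpace ℝ (Fin q)} {us : Fin n → Fin (r + 1) → EuclideanSpace ℝ (Fin q)}
    (hk : IsKKT f0 f d xs lam us) (hx : IsSolution f0 f d x) : x = xs := by
  have hxd := mem_effDomain_of_globalCost_lt_top hf hx.1.2
  have h1 := hx.2 xs hk.sum_eq
  rw [globalCost_eq_realCost hf hxd, globalCost_eq_realCost hf fun i j => (hk.subgradient i j).1,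
    EReal.coe_le_coe_iff] at h1
  have hterm : ∀ i, f0 i (xs i) + ∑ j, (f i j (xs i)).toReal + inner ℝ lam (x i - xs i)
      + c / 2 * ‖x i - xs i‖ ^ 2 ≤ f0 i (x i) + ∑ j, (f i j (x i)).toReal := by
    intro i
    have h2 := quadratic_lower_bound ((hf0 i).differentiable two_ne_zero) (hf0c i) (xs i) (x i)
    have h3 := Finset.sum_le_sum fun j (_ : j ∈ Finset.univ) =>
      (hk.subgradient i j).2 (x i) (hxd i j)
    rw [Finset.sum_add_distrib, ← sum_inner] at h3
    rw [← hk.stationary i, inner_add_left]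
    linarith
  have hsum := Finset.sum_le_sum fun i (_ : i ∈ Finset.univ) => hterm i
  rw [Finset.sum_add_distrib, Finset.sum_add_distrib, ← inner_sum, Finset.sum_sub_distrib,
    hx.1.1, hk.sum_eq, sub_self, inner_zero_right, add_zero, ← Finset.mul_sum] at hsum
  simp only [realCost] at h1
  have h2 : ∑ i, ‖x i - xs i‖ ^ 2 ≤ 0 := by
    by_contra! h
    nlinarith [mul_pos hc0 h]
  have h3 := (Finset.sum_eq_zero_iff_of_nonneg fun i _ => sq_nonneg ‖x i - xs i‖).1
    (le_antisymm h2 (Finset.sum_nonneg fun i _ => sq_nonneg _))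
  funext i
  have h4 := h3 i (Finset.mem_univ i)
  rw [pow_eq_zero_iff two_ne_zero, norm_eq_zero, sub_eq_zero] at h4
  exact h4

/-- Bounding the nonsmooth terms by chords and differentiating the smooth ones shows that `xs` also
solves the problem with linearised smooth part. This makes the gradients at `xs` appear exactly in
the multiplier. -/
theorem IsSolution.sum_inner_gradient_add_nonneg (hf0 : ∀ i, ContDiff ℝ 2 (f0 i))
    (hf : ∀ i j, IsClosedProperConvex (f i j)) {xs s : Fin n → EuclideanSpace ℝ (Fin q)}
    (hxs : IsSolution f0 f d xs) (hs : ∑ i, s i = 0)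
    (hsd : ∀ i j, xs i + s i ∈ effDomain (f i j)) :
    0 ≤ ∑ i, (inner ℝ (∇ (f0 i) (xs i)) (s i) +
      ∑ j, ((f i j (xs i + s i)).toReal - (f i j (xs i)).toReal)) := by
  have hxd := mem_effDomain_of_globalCost_lt_top hf hxs.1.2
  set A := ∑ i, ∑ j, ((f i j (xs i + s i)).toReal - (f i j (xs i)).toReal) with hA
  have hderiv : HasDerivAt (fun t : ℝ => ∑ i, f0 i (xs i + t • s i) + t * A)
      (∑ i, inner ℝ (∇ (f0 i) (xs i)) (s i) + A) 0 := by
    have h1 : HasDerivAt (fun t : ℝ => ∑ i, f0 i (xs i + t • s i))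
        (∑ i, inner ℝ (∇ (f0 i) (xs i)) (s i)) 0 := by
      refine HasDerivAt.fun_sum fun i _ => ?_
      have := hasDerivAt_comp_add_smul ((hf0 i).differentiable two_ne_zero) (xs i) (s i) 0
      simpa using this
    exact (h1.fun_add ((hasDerivAt_id (0 : ℝ)).mul_const A)).congr_deriv (by simp)
  have hge : ∀ t ∈ Ioc (0 : ℝ) 1, ∑ i, f0 i (xs i) ≤ ∑ i, f0 i (xs i + t • s i) + t * A := by
    intro t ht
    have e : ∀ i, (1 - t) • xs i + t • (xs i + s i) = xs i + t • s i := fun i => by module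
    have htd : ∀ i j, xs i + t • s i ∈ effDomain (f i j) := fun i j => by
      rw [← e]
      exact (hf i j).convexOn.1 (hxd i j) (hsd i j) (sub_nonneg.2 ht.2) ht.1.le (by ring)
    have h1 := hxs.2 (fun i => xs i + t • s i) (by
      rw [Finset.sum_add_distrib, ← Finset.smul_sum, hs, smul_zero, add_zero, hxs.1.1])
    rw [globalCost_eq_realCost hf hxd, globalCost_eq_realCost hf htd, EReal.coe_le_coe_iff] at h1
    have h2 : ∑ i, ∑ j, (f i j (xs i + t • s i)).toReal ≤
        ∑ i, ∑ j, ((f i j (xs i)).toReal +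
          t * ((f i j (xs i + s i)).toReal - (f i j (xs i)).toReal)) := by
      refine Finset.sum_le_sum fun i _ => Finset.sum_le_sum fun j _ => ?_
      have := (hf i j).convexOn.2 (hxd i j) (hsd i j) (sub_nonneg.2 ht.2) ht.1.le (by ring)
      rw [e] at this
      simp only [smul_eq_mul] at this
      linarith
    simp only [Finset.sum_add_distrib, ← Finset.mul_sum] at h2
    simp only [realCost, Finset.sum_add_distrib] at h1
    linarith
  rw [Finset.sum_add_distrib, ← hA]
  have hslope := (hasDerivAt_iff_tendsto_slope.1 hderiv).mono_left
    (nhdsWithin_mono 0 (fun t (ht : t ∈ Ioi (0 : ℝ)) => ne_of_gt ht))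
  refine ge_of_tendsto hslope ?_
  filter_upwards [Ioc_mem_nhdsGT (zero_lt_one' ℝ)] with t ht
  rw [slope_def_field]
  refine div_nonneg ?_ (by linarith [ht.1])
  have := hge t ht
  simp only [zero_smul, add_zero, zero_mul]
  linarith

end Optimality

/-! ### Existence of a common multiplier, by giving each nonsmooth cost its own copy of the
variable. -/

section Optimality

variable {n q r : ℕ} {f0 : Fin n → EuclideanSpace ℝ (Fin q) → ℝ}
  {f : Fin n → Fin (r + 1) → EuclideanSpace ℝ (Fin q) → EReal}
  {d : Fin n → EuclideanSpace ℝ (Fin q)}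

/-- The blockwise constant perturbations which preserve the resource constraint. -/
def balancedSubmodule (n q r : ℕ) :
    Submodule ℝ (Fin n → Fin (r + 1) → EuclideanSpace ℝ (Fin q)) where
  carrier := {X | ∃ x : Fin n → EuclideanSpace ℝ (Fin q), ∑ i, x i = 0 ∧ ∀ i j, X i j = x i}
  zero_mem' := ⟨0, by simp, by simp⟩
  add_mem' := by
    rintro X Y ⟨x, hx, hX⟩ ⟨y, hy, hY⟩
    exact ⟨x + y, by simp [Finset.sum_add_distrib, hx, hy], fun i j => by simp [hX, hY]⟩
  smul_mem' := by
    rintro c X ⟨x, hx, hX⟩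
    exact ⟨c • x, by simp [← Finset.smul_sum, hx], fun i j => by simp [hX]⟩

theorem exists_dual_blocks (u : (Fin n → Fin (r + 1) → EuclideanSpace ℝ (Fin q)) →ₗ[ℝ] ℝ) :
    ∃ U : Fin n → Fin (r + 1) → EuclideanSpace ℝ (Fin q),
      ∀ X, u X = ∑ i, ∑ j, inner ℝ (U i j) (X i j) := by
  refine ⟨fun i j => (InnerProductSpace.toDual ℝ (EuclideanSpace ℝ (Fin q))).symm
    (LinearMap.toContinuousLinearMap (u.comp ((LinearMap.single ℝ _ i).comp
      (LinearMap.single ℝ (fun _ : Fin (r + 1) => EuclideanSpace ℝ (Fin q)) j)))), fun X => ?_⟩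
  simp only [InnerProductSpace.toDual_symm_apply, LinearMap.coe_toContinuousLinearMap',
    LinearMap.comp_apply, LinearMap.coe_single]
  simp only [← map_sum]
  congr 1
  ext i j : 2
  rw [Finset.sum_apply, Finset.sum_apply, Finset.sum_eq_single i]
  · rw [Finset.sum_apply, Finset.sum_apply, Finset.sum_eq_single j]
    · simp
    · intro k _ hk
      rw [Pi.single_eq_same, Pi.single_eq_of_ne hk.symm]
    · simp
  · intro k _ hk
    simp [hk.symm]
  · simp

/-- With one copy of the variable per cost, `g` separates and its subgradient splits into blocks.
Agreement of the copies and the resource constraint move into the subspace; vanishing there says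
that the block sums `∑ j, U i j` are independent of `i`, and their value is the multiplier. -/
theorem IsSolution.exists_isKKT (hf0 : ∀ i, ContDiff ℝ 2 (f0 i))
    (hf : ∀ i j, IsClosedProperConvex (f i j))
    (hfeas : ∃ y : Fin n → EuclideanSpace ℝ (Fin q), ∑ i, y i = ∑ i, d i ∧
      ∀ i j, y i ∈ intrinsicInterior ℝ (effDomain (f i j)))
    {xs : Fin n → EuclideanSpace ℝ (Fin q)} (hxs : IsSolution f0 f d xs) :
    ∃ lam us, IsKKT f0 f d xs lam us := by
  obtain ⟨y, hy, hyr⟩ := hfeas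
  have hyd : ∀ i j, y i ∈ effDomain (f i j) := fun i j => intrinsicInterior_subset (hyr i j)
  have hxd := mem_effDomain_of_globalCost_lt_top hf hxs.1.2
  set D : Set (Fin n → Fin (r + 1) → EuclideanSpace ℝ (Fin q)) :=
    {X | ∀ i j, X i j ∈ effDomain (f i j)}
  -- The linearised smooth cost is attached to the last block only; `us` subtracts it there again.
  set g : (Fin n → Fin (r + 1) → EuclideanSpace ℝ (Fin q)) → ℝ := fun X =>
    ∑ i, (inner ℝ (∇ (f0 i) (xs i)) (X i (Fin.last r)) + ∑ j, (f i j (X i j)).toReal) with hg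
  have hconv : ConvexOn ℝ D g := by
    refine ⟨fun X hX Y hY a b ha hb hab i j => (hf i j).convexOn.1 (hX i j) (hY i j) ha hb hab, ?_⟩
    intro X hX Y hY a b ha hb hab
    simp only [hg, smul_eq_mul, Finset.mul_sum]
    rw [← Finset.sum_add_distrib]
    refine Finset.sum_le_sum fun i _ => ?_
    have h1 := Finset.sum_le_sum fun j (_ : j ∈ Finset.univ) =>
      (hf i j).convexOn.2 (hX i j) (hY i j) ha hb hab
    simp only [smul_eq_mul, Finset.sum_add_distrib, ← Finset.mul_sum] at h1
    simp only [Pi.add_apply, Pi.smul_apply, inner_add_right, inner_smul_right]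
    linarith
  set XS : Fin n → Fin (r + 1) → EuclideanSpace ℝ (Fin q) := fun i _ => xs i
  obtain ⟨u, huS, hu⟩ := exists_subgradient_of_forall_le hconv (balancedSubmodule n q r)
    (xs := XS) (y := fun i _ => y i) hxd
    (by
      rintro s ⟨x, hx, hsx⟩ hs
      have h1 := hxs.sum_inner_gradient_add_nonneg hf0 hf hx fun i j => by
        have := hs i j
        rwa [Pi.add_apply, Pi.add_apply, hsx] at this
      simp only [hg, XS, Pi.add_apply, hsx, inner_add_right]
      rw [← sub_nonneg, ← Finset.sum_sub_distrib]
      refine h1.trans (le_of_eq (Finset.sum_congr rfl fun i _ => ?_))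
      rw [Finset.sum_sub_distrib]
      ring)
    ⟨fun i => y i - xs i, by rw [Finset.sum_sub_distrib, hy, hxs.1.1, sub_self],
      fun i j => rfl⟩ hyd
    (by
      intro X hX
      have h1 : ∀ᶠ ε in 𝓝 (0 : ℝ), ∀ i j, y i - ε • (X i j - y i) ∈ effDomain (f i j) :=
        eventually_all.2 fun i => eventually_all.2 fun j =>
          eventually_sub_smul_mem_of_mem_intrinsicInterior (hyr i j) (hX i j)
      obtain ⟨ε, h2, h3⟩ := ((h1.filter_mono nhdsWithin_le_nhds).and
        (self_mem_nhdsWithin : Ioi (0 : ℝ) ∈ 𝓝[>] 0)).exists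
      exact ⟨ε, h3, h2⟩)
  obtain ⟨U, hU⟩ := exists_dual_blocks u
  set us : Fin n → Fin (r + 1) → EuclideanSpace ℝ (Fin q) := fun i j =>
    U i j - if j = Fin.last r then ∇ (f0 i) (xs i) else 0
  have hsub : ∀ i j, IsSubgradientAt (f i j) (us i j) (xs i) := by
    intro i j
    refine ⟨hxd i j, fun δ hδ => ?_⟩
    set X : Fin n → Fin (r + 1) → EuclideanSpace ℝ (Fin q) :=
      Function.update XS i (Function.update (XS i) j δ) with hX
    have hXi : ∀ k, k ≠ i → X k = XS k := fun k hk => Function.update_of_ne hk _ _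
    have hXii : X i = Function.update (XS i) j δ := Function.update_self ..
    have hXD : X ∈ D := by
      intro k l
      by_cases hk : k = i
      · subst hk
        rw [hXii]
        by_cases hl : l = j
        · subst hl
          rwa [Function.update_self]
        · rw [Function.update_of_ne hl]
          exact hxd k l
      · rw [hXi k hk]
        exact hxd k l
    have h1 := hu X hXD
    have h2 : u (X - XS) = inner ℝ (U i j) (δ - xs i) := by
      rw [hU, Finset.sum_eq_single i, Finset.sum_eq_single j]
      · simp [hXii, XS]
      · intro l _ hl
        simp [hXii, hl]
      · simp
      · intro k _ hk
        simp [hXi k hk]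
      · simp
    have h3 : g X - g XS = (if j = Fin.last r then inner ℝ (∇ (f0 i) (xs i)) (δ - xs i) else 0)
        + ((f i j δ).toReal - (f i j (xs i)).toReal) := by
      simp only [hg]
      rw [← Finset.sum_sub_distrib, Finset.sum_eq_single i]
      · rw [add_sub_add_comm, ← Finset.sum_sub_distrib, Finset.sum_eq_single j, ← inner_sub_right,
          hXii, Function.update_self]
        · congr 1
          by_cases hj : j = Fin.last r
          · subst hj
            simp [XS]
          · simp [hj, Function.update_of_ne (Ne.symm hj)]
        · intro l _ hl
          rw [hXii, Function.update_of_ne hl, sub_self]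
        · simp
      · intro k _ hk
        rw [hXi k hk, sub_self]
      · simp
    have h4 : inner ℝ (us i j) (δ - xs i) = inner ℝ (U i j) (δ - xs i) -
        (if j = Fin.last r then inner ℝ (∇ (f0 i) (xs i)) (δ - xs i) else 0) := by
      simp only [us, inner_sub_left]
      split_ifs <;> simp
    rw [h4]
    linarith
  have hstat : ∀ i, ∇ (f0 i) (xs i) + ∑ j, us i j = ∑ j, U i j := by
    intro i
    simp [us, Finset.sum_sub_distrib]
  have hcommon : ∀ i k, ∑ j, U i j = ∑ j, U k j := by
    intro i k
    rw [← sub_eq_zero]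
    set e := ∑ j, U i j - ∑ j, U k j with he
    -- Test with the transfer of `e` from agent `k` to agent `i` in every block, which keeps the
    -- constraint.
    have h1 := huS (fun l _ => Pi.single (M := fun _ => EuclideanSpace ℝ (Fin q)) i e l
        - Pi.single (M := fun _ => EuclideanSpace ℝ (Fin q)) k e l)
      ⟨fun l => Pi.single (M := fun _ => EuclideanSpace ℝ (Fin q)) i e l
        - Pi.single (M := fun _ => EuclideanSpace ℝ (Fin q)) k e l, by
        rw [Finset.sum_sub_distrib, Finset.sum_pi_single', Finset.sum_pi_single']
        simp, fun _ _ => rfl⟩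
    rw [hU] at h1
    simp only [← sum_inner, inner_sub_right, Finset.sum_sub_distrib] at h1
    rw [Finset.sum_eq_single i (by intro l _ hl; simp [hl]) (by simp),
      Finset.sum_eq_single k (by intro l _ hl; simp [hl]) (by simp)] at h1
    simp only [Pi.single_eq_same] at h1
    rw [← inner_sub_left, ← he] at h1
    exact inner_self_eq_zero.1 h1
  rcases n.eq_zero_or_pos with hn | hn
  · subst hn
    exact ⟨0, us, hxs.1.1, hsub, fun i => i.elim0⟩
  · exact ⟨∑ j, U ⟨0, hn⟩ j, us, hxs.1.1, hsub, fun i => (hstat i).trans (hcommon _ _)⟩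

end Optimality

/-! ### Global solutions of bounded autonomous differential equations -/

section ODE

theorem antitoneOn_of_hasDerivWithinAt {s : Set ℝ} (hs : Convex ℝ s) {V V' : ℝ → ℝ}
    (hV : ∀ t ∈ s, HasDerivWithinAt V (V' t) s t) (hV' : ∀ t ∈ s, V' t ≤ 0) : AntitoneOn V s :=
  antitoneOn_of_hasDerivWithinAt_nonpos hs (fun t ht => (hV t ht).continuousWithinAt)
    (fun t ht => (hV t (interior_subset ht)).mono interior_subset)
    fun t ht => hV' t (interior_subset ht)

/-- Barbalat's lemma, for a nonnegative Lyapunov function which dissipates `δ * φ`. -/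
theorem tendsto_zero_of_dissipation {V V' φ φ' : ℝ → ℝ} {δ K : ℝ} (hδ : 0 < δ) (hK : 0 < K)
    (hV : ∀ t ∈ Ici (0 : ℝ), HasDerivWithinAt V (V' t) (Ici 0) t)
    (hV' : ∀ t ∈ Ici (0 : ℝ), V' t ≤ -(δ * φ t)) (hV0 : ∀ t ∈ Ici (0 : ℝ), 0 ≤ V t)
    (hφ : ∀ t ∈ Ici (0 : ℝ), HasDerivWithinAt φ (φ' t) (Ici 0) t)
    (hφ' : ∀ t ∈ Ici (0 : ℝ), -K ≤ φ' t) (hφ0 : ∀ t ∈ Ici (0 : ℝ), 0 ≤ φ t) :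
    Tendsto φ atTop (𝓝 0) := by
  have hanti : AntitoneOn V (Ici 0) := antitoneOn_of_hasDerivWithinAt (convex_Ici 0) hV
    fun t ht => (hV' t ht).trans (by
      have := mul_nonneg hδ.le (hφ0 t ht)
      linarith)
  have hφanti : AntitoneOn (fun t => -φ t - K * t) (Ici 0) :=
    antitoneOn_of_hasDerivWithinAt (convex_Ici 0) (V' := fun t => -φ' t - K * 1)
      (fun t ht => (hφ t ht).fun_neg.fun_sub ((hasDerivWithinAt_id t _).const_mul K)) fun t ht => by
        have := hφ' t ht
        linarith
  set l := sInf (V '' Ici 0)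
  have hbdd : BddBelow (V '' Ici 0) := ⟨0, by rintro _ ⟨t, ht, rfl⟩; exact hV0 t ht⟩
  have hl : ∀ t ∈ Ici (0 : ℝ), l ≤ V t := fun t ht => csInf_le hbdd ⟨t, ht, rfl⟩
  rw [Metric.tendsto_atTop]
  intro ε hε
  -- Since `φ' ≥ -K`, a value of at least `ε` stays above `ε / 2` for the time `τ` and costs `V` at
  -- least `δ * (ε / 2) * τ`. At `t₀` the function `V` is already closer than that to its infimum.
  set τ := ε / (2 * K)
  have hτ : 0 < τ := by positivity
  have hKτ : K * τ = ε / 2 := by simp only [τ]; field_simp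
  obtain ⟨_, ⟨t₀, ht₀, rfl⟩, hVt₀⟩ := exists_lt_of_csInf_lt (s := V '' Ici 0)
    ⟨_, 0, self_mem_Ici, rfl⟩
    (show l < l + δ * (ε / 2) * τ by linarith [show 0 < δ * (ε / 2) * τ by positivity])
  refine ⟨t₀, fun t ht => ?_⟩
  have ht0 : t ∈ Ici (0 : ℝ) := le_trans (mem_Ici.1 ht₀) ht
  rw [Real.dist_eq, sub_zero, abs_of_nonneg (hφ0 t ht0)]
  by_contra! hge
  have hsub : Icc t (t + τ) ⊆ Ici 0 := fun s hs => le_trans (mem_Ici.1 ht0) hs.1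
  have hdrop : AntitoneOn (fun s => V s + δ * (ε / 2) * s) (Icc t (t + τ)) :=
    antitoneOn_of_hasDerivWithinAt (convex_Icc _ _) (V' := fun s => V' s + δ * (ε / 2) * 1)
      (fun s hs => ((hV s (hsub hs)).mono hsub).fun_add
        ((hasDerivWithinAt_id s _).const_mul (δ * (ε / 2)))) fun s hs => by
        have h1 := hφanti ht0 (hsub hs) hs.1
        have h2 := hV' s (hsub hs)
        simp only at h1
        have h3 : K * (s - t) ≤ K * τ := mul_le_mul_of_nonneg_left (by linarith [hs.2]) hK.le
        have h4 : ε / 2 ≤ φ s := by linarith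
        have h5 := mul_le_mul_of_nonneg_left h4 hδ.le
        linarith
  have h1 := hdrop (left_mem_Icc.2 (by linarith)) (right_mem_Icc.2 (by linarith))
    (show t ≤ t + τ by linarith)
  have h2 := hl (t + τ) (hsub (right_mem_Icc.2 (by linarith)))
  have h3 := hanti ht₀ ht0 ht
  simp only at h1
  linarith

variable {X : Type*} [NormedAddCommGroup X] [NormedSpace ℝ X] {F : X → X}

/-- Derivatives within a single point are unconstrained; this covers the degenerate interval `Icc 0
0`. -/
theorem hasDerivWithinAt_singleton (u : ℝ → X) (y : X) (a : ℝ) : HasDerivWithinAt u y {a} a := by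
  have h : HasDerivWithinAt (fun t : ℝ => u a + (t - a) • y) y {a} a := by
    have := ((((hasDerivAt_id a).sub_const a).smul_const y).const_add (u a)).hasDerivWithinAt
      (s := {a})
    simpa using this
  exact h.congr (by simp) (by simp)

theorem hasDerivWithinAt_ite_Icc {u v : ℝ → X} {T T' : ℝ} (h0 : 0 ≤ T) (hT : T ≤ T')
    (huv : u T = v T)
    (hu : ∀ t ∈ Icc 0 T, HasDerivWithinAt u (F (u t)) (Icc 0 T) t)
    (hv : ∀ t ∈ Icc T T', HasDerivWithinAt v (F (v t)) (Icc T T') t) (t : ℝ) :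
    HasDerivWithinAt (fun s => if s ≤ T then u s else v s) (F (if t ≤ T then u t else v t))
      (Icc 0 T') t := by
  set w : ℝ → X := fun s => if s ≤ T then u s else v s
  have hwu : ∀ s ∈ Icc 0 T, w s = u s := fun s hs => if_pos hs.2
  have hwv : ∀ s ∈ Icc T T', w s = v s := fun s hs => by
    rcases hs.1.eq_or_lt with h | h
    · simp [w, ← h, huv]
    · exact if_neg (not_le.2 h)
  change HasDerivWithinAt w (F (w t)) (Icc 0 T') t
  rw [← Icc_union_Icc_eq_Icc h0 hT]
  refine HasDerivWithinAt.union ?_ ?_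
  · by_cases h : t ∈ Icc 0 T
    · rw [hwu t h]
      exact (hu t h).congr hwu (hwu t h)
    · exact hasDerivWithinAt_iff_hasFDerivWithinAt.2
        (HasFDerivWithinAt.of_notMem_closure (by rwa [isClosed_Icc.closure_eq]))
  · by_cases h : t ∈ Icc T T'
    · rw [hwv t h]
      exact (hv t h).congr hwv (hwv t h)
    · exact hasDerivWithinAt_iff_hasFDerivWithinAt.2
        (HasFDerivWithinAt.of_notMem_closure (by rwa [isClosed_Icc.closure_eq]))

/-- An autonomous differential equation with a locally Lipschitz vector field has a global forward
solution from each initial value for which the solutions on compact intervals obey an a priori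
bound. -/
theorem exists_global_solution [CompleteSpace X]
    (hF : ∀ R : ℝ, ∃ K : NNReal, LipschitzOnWith K F (Metric.closedBall 0 R)) {x₀ : X} {R : ℝ}
    (hb : ∀ T, 0 ≤ T → ∀ u : ℝ → X, u 0 = x₀ →
      (∀ t ∈ Icc 0 T, HasDerivWithinAt u (F (u t)) (Icc 0 T) t) → ∀ t ∈ Icc 0 T, ‖u t‖ ≤ R) :
    ∃ u : ℝ → X, u 0 = x₀ ∧ ∀ t, 0 ≤ t → HasDerivWithinAt u (F (u t)) (Ici 0) t := by
  have hR : 0 ≤ R := by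
    refine (norm_nonneg x₀).trans (hb 0 le_rfl (fun _ => x₀) rfl (fun t ht => ?_) 0 (by simp))
    rw [Icc_self] at ht ⊢
    rw [mem_singleton_iff.1 ht]
    exact hasDerivWithinAt_singleton ..
  -- The unit margin lets a Picard step from any state of norm at most `R` have the uniform length
  -- `ε`. The a priori bound returns each endpoint to the ball of radius `R`, so steps can be
  -- repeated indefinitely.
  obtain ⟨K, hK⟩ := hF (R + 1)
  set L : NNReal := ‖F 0‖₊ + K * (R.toNNReal + 1)
  have hL : ∀ x ∈ Metric.closedBall (0 : X) (R + 1), ‖F x‖ ≤ L := fun x hx => by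
    have h1 := hK.norm_sub_le hx (Metric.mem_closedBall_self (by linarith))
    have h2 : ‖F x‖ ≤ ‖F 0‖ + ‖F x - F 0‖ := by
      have := norm_add_le (F 0) (F x - F 0)
      rwa [add_sub_cancel] at this
    have h3 : ‖x‖ ≤ R + 1 := by simpa using hx
    have h4 : (K : ℝ) * ‖x - 0‖ ≤ K * (R + 1) := by
      rw [sub_zero]
      exact mul_le_mul_of_nonneg_left h3 K.2
    have h5 : (L : ℝ) = ‖F 0‖ + K * (R + 1) := by simp [L, Real.coe_toNNReal _ hR]
    linarith
  set ε : ℝ := 1 / (L + 1)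
  have hε : 0 < ε := by positivity
  have hstep : ∀ (T : ℝ) (x : X), ‖x‖ ≤ R → ∃ v : ℝ → X, v T = x ∧
      ∀ t ∈ Icc T (T + ε), HasDerivWithinAt v (F (v t)) (Icc T (T + ε)) t := by
    intro T x hx
    have hsub : Metric.closedBall x ((1 : NNReal) : ℝ) ⊆ Metric.closedBall 0 (R + 1) := by
      refine Metric.closedBall_subset_closedBall' ?_
      rw [dist_zero_right, NNReal.coe_one]
      linarith
    have hp : IsPicardLindelof (fun _ => F) (tmin := T) (tmax := T + ε)
        ⟨T, by simp [hε.le]⟩ x 1 0 L K :=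
      IsPicardLindelof.of_time_independent (fun y hy => hL y (hsub hy)) (hK.mono hsub) (by
        simp only [add_sub_cancel_left, sub_self, max_eq_left hε.le, NNReal.coe_one,
          NNReal.coe_zero, sub_zero, ε]
        rw [mul_one_div, div_le_one (by positivity)]
        linarith)
    exact hp.exists_eq_forall_mem_Icc_hasDerivWithinAt₀
  have hex : ∀ k : ℕ, ∃ u : ℝ → X, u 0 = x₀ ∧
      ∀ t ∈ Icc 0 (k * ε), HasDerivWithinAt u (F (u t)) (Icc 0 (k * ε)) t := by
    intro k
    induction k with
    | zero =>
      refine ⟨fun _ => x₀, rfl, fun t ht => ?_⟩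
      simp only [Nat.cast_zero, zero_mul, Icc_self, mem_singleton_iff] at ht ⊢
      rw [ht]
      exact hasDerivWithinAt_singleton ..
    | succ k ih =>
      obtain ⟨u, hu0, hu⟩ := ih
      have hkε : 0 ≤ k * ε := by positivity
      obtain ⟨v, hv0, hv⟩ := hstep (k * ε) (u (k * ε))
        (hb _ hkε u hu0 hu _ (right_mem_Icc.2 hkε))
      have e : ((k + 1 : ℕ) : ℝ) * ε = k * ε + ε := by push_cast; ring
      refine ⟨fun s => if s ≤ k * ε then u s else v s, by simp [hkε, hu0], fun t _ => ?_⟩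
      rw [e]
      exact hasDerivWithinAt_ite_Icc hkε (by linarith) hv0.symm hu hv t
  choose u hu0 hu using hex
  have huniq : ∀ k m : ℕ, k ≤ m → EqOn (u k) (u m) (Icc 0 (k * ε)) := by
    intro k m hkm
    have hkm' : (k : ℝ) * ε ≤ m * ε := by gcongr
    have hsub : Icc 0 (k * ε) ⊆ Icc 0 (m * ε) := Icc_subset_Icc_right hkm'
    have hm := fun t ht => (hu m t (hsub ht)).mono hsub
    have hright : ∀ w : ℝ → X, (∀ t ∈ Icc 0 (k * ε),
        HasDerivWithinAt w (F (w t)) (Icc 0 (k * ε)) t) → ∀ t ∈ Ico 0 (k * ε),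
        HasDerivWithinAt w (F (w t)) (Ici t) t := fun w hw t ht =>
      (hw t (Ico_subset_Icc_self ht)).mono_of_mem_nhdsWithin (Icc_mem_nhdsGE_of_mem ht)
    refine ODE_solution_unique_of_mem_Icc_right (v := fun _ => F) (K := K)
      (s := fun _ => Metric.closedBall 0 (R + 1)) (fun _ _ => hK)
      (fun t ht => (hu k t ht).continuousWithinAt) (hright _ (hu k)) (fun t ht => ?_)
      (fun t ht => (hm t ht).continuousWithinAt) (hright _ hm) (fun t ht => ?_)
      ((hu0 k).trans (hu0 m).symm)
    · have := hb _ (by positivity) _ (hu0 k) (hu k) t (Ico_subset_Icc_self ht)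
      rw [mem_closedBall_zero_iff]
      linarith
    · have := hb _ (by positivity) _ (hu0 m) (hu m) t (hsub (Ico_subset_Icc_self ht))
      rw [mem_closedBall_zero_iff]
      linarith
  have huniq' : ∀ k m : ℕ, ∀ t, 0 ≤ t → t ≤ k * ε → t ≤ m * ε → u k t = u m t := by
    intro k m t h0 hk hm
    rcases le_total k m with h | h
    · exact huniq k m h ⟨h0, hk⟩
    · exact (huniq m k h ⟨h0, hm⟩).symm
  -- The `+ 1` puts `t` strictly before the end of its interval, so the derivative there is one
  -- within `Ici 0`.
  set N : ℝ → ℕ := fun t => ⌈t / ε⌉₊ + 1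
  have hN : ∀ t, t < N t * ε := fun t => by
    have h1 := Nat.le_ceil (t / ε)
    rw [div_le_iff₀ hε] at h1
    have h2 : (N t : ℝ) * ε = ⌈t / ε⌉₊ * ε + ε := by simp only [N]; push_cast; ring
    linarith
  refine ⟨fun t => u (N t) t, hu0 _, fun t ht => ?_⟩
  have hder : HasDerivWithinAt (u (N t)) (F (u (N t) t)) (Ici 0) t :=
    (hu (N t) t ⟨ht, (hN t).le⟩).mono_of_mem_nhdsWithin (by
      rw [← Ici_inter_Iic]
      exact inter_mem_nhdsWithin _ (Iic_mem_nhds (hN t)))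
  refine hder.congr_of_eventuallyEq ?_ rfl
  filter_upwards [self_mem_nhdsWithin, mem_nhdsWithin_of_mem_nhds (Iio_mem_nhds (hN t))]
    with s hs hs'
  exact huniq' _ _ s hs (hN s).le hs'.le

end ODE

/-! ### The energy of a single agent -/

section Agent

variable {E : Type*} [NormedAddCommGroup E] [InnerProductSpace ℝ E] [CompleteSpace E] {φ : E → ℝ}

theorem contDiff_gradient (hφ : ContDiff ℝ 2 φ) : ContDiff ℝ 1 (∇ φ) := by
  have h1 : ContDiff ℝ 1 (fderiv ℝ φ) := hφ.fderiv_right (by norm_num)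
  exact (InnerProductSpace.toDual ℝ E).symm.contDiff.comp h1

theorem hessian_lower_bound (hφ : ContDiff ℝ 2 φ) {c : ℝ}
    (hc : ∀ a b, c * ‖a - b‖ ^ 2 ≤ inner ℝ (∇ φ a - ∇ φ b) (a - b)) (a s : E) :
    c * ‖s‖ ^ 2 ≤ inner ℝ s (fderiv ℝ (∇ φ) a s) := by
  have hd : HasDerivAt (fun t : ℝ => inner ℝ s (∇ φ (a + t • s))) (inner ℝ s (fderiv ℝ (∇ φ) a s))
      0 := by
    have h1 : HasDerivAt (fun t : ℝ => a + t • s) s 0 := by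
      simpa using ((hasDerivAt_id (0 : ℝ)).smul_const s).const_add a
    have h2 : HasFDerivAt (∇ φ) (fderiv ℝ (∇ φ) a) (a + (0 : ℝ) • s) := by
      rw [zero_smul, add_zero]
      exact ((contDiff_gradient hφ).differentiable one_ne_zero a).hasFDerivAt
    have h3 := (hasDerivAt_const (0 : ℝ) s).inner ℝ (h2.comp_hasDerivAt (0 : ℝ) h1)
    refine h3.congr_deriv ?_
    simp
  have hslope := (hasDerivAt_iff_tendsto_slope.1 hd).mono_left
    (nhdsWithin_mono 0 (fun t (ht : t ∈ Ioi (0 : ℝ)) => ne_of_gt ht))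
  refine ge_of_tendsto hslope ?_
  filter_upwards [self_mem_nhdsWithin] with t ht
  have ht' : 0 < t := ht
  rw [slope_def_field, sub_zero, le_div_iff₀ ht', zero_smul, add_zero, ← inner_sub_right]
  have h1 := hc (a + t • s) a
  rw [add_sub_cancel_left, norm_smul, inner_smul_right, mul_pow, Real.norm_eq_abs, sq_abs,
    real_inner_comm] at h1
  exact le_of_mul_le_mul_left (by linarith) ht'

/-- The storage function of a single agent. -/
def agentEnergy {r : ℕ} (φ : E → ℝ) (g : E → EReal) (γ : ℝ) (xs ys : E) (zs : Fin r → E)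
    (x : E) (z : Fin r → E) (v : E) : ℝ :=
  proxPotential g (x - ∇ φ x + v + γ • ∑ j, z j) - inner ℝ x (x - ∇ φ x + v + γ • ∑ j, z j)
    + 1 / 2 * ‖x‖ ^ 2 + 1 / 2 * ‖x - xs‖ ^ 2 + inner ℝ ys (x - xs) + (g xs).toReal
    + γ / 2 * ∑ j, ‖z j - zs j‖ ^ 2

variable [ProperSpace E] {r : ℕ} {g : E → EReal} {γ c : ℝ} {xs ys lam : E} {zs : Fin r → E}

/-- Fenchel–Young tested at `xs` reduces the first terms to `-⟨θ - x - ys, x - xs⟩`. Strong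
monotonicity supplies `c`, and Young's inequality for `z` costs `γ * r` and half of the `z` energy.
The product with `v - lam` is left over and handled in `le_lyapunov`. -/
theorem le_agentEnergy (hγ : 0 < γ)
    (hc : ∀ a b, c * ‖a - b‖ ^ 2 ≤ inner ℝ (∇ φ a - ∇ φ b) (a - b))
    (hg : IsClosedProperConvex g) (hys : IsSubgradientAt g ys xs)
    (hlam : ys = -∇ φ xs + lam + γ • ∑ j, zs j) (x : E) (z : Fin r → E) (v : E) :
    (c - γ * r) * ‖x - xs‖ ^ 2 + γ / 4 * ∑ j, ‖z j - zs j‖ ^ 2 - inner ℝ (v - lam) (x - xs) ≤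
      agentEnergy φ g γ xs ys zs x z v := by
  set θ := x - ∇ φ x + v + γ • ∑ j, z j with hθ
  have h1 := hg.le_proxPotential θ hys.1
  have h2 := hc x xs
  have h3 : ∑ j, inner ℝ (z j - zs j) (x - xs) ≤
      ∑ j, (1 / 4 * ‖z j - zs j‖ ^ 2 + ‖x - xs‖ ^ 2) := by
    refine Finset.sum_le_sum fun j _ => ?_
    have h4 := real_inner_le_norm (z j - zs j) (x - xs)
    nlinarith [sq_nonneg (1 / 2 * ‖z j - zs j‖ - ‖x - xs‖)]
  rw [Finset.sum_add_distrib, ← Finset.mul_sum, Finset.sum_const, Finset.card_univ,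
    Fintype.card_fin, nsmul_eq_mul] at h3
  have h5 := mul_le_mul_of_nonneg_left h3 hγ.le
  have h6 : inner ℝ θ xs - 1 / 2 * ‖xs‖ ^ 2 - inner ℝ x θ + 1 / 2 * ‖x‖ ^ 2
      + 1 / 2 * ‖x - xs‖ ^ 2 + inner ℝ ys (x - xs) = -inner ℝ (θ - x - ys) (x - xs) := by
    rw [norm_sub_sq_real]
    simp only [inner_sub_left, inner_sub_right, real_inner_self_eq_norm_sq]
    rw [real_inner_comm θ x]
    ring
  have h7 : θ - x - ys = -(∇ φ x - ∇ φ xs) + (v - lam) + γ • ∑ j, (z j - zs j) := by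
    rw [hθ, hlam, Finset.sum_sub_distrib]
    module
  have h8 : inner ℝ (θ - x - ys) (x - xs) = -inner ℝ (∇ φ x - ∇ φ xs) (x - xs)
      + inner ℝ (v - lam) (x - xs) + γ * ∑ j, inner ℝ (z j - zs j) (x - xs) := by
    rw [h7, inner_add_left, inner_add_left, inner_neg_left, real_inner_smul_left, sum_inner]
  unfold agentEnergy
  rw [← hθ]
  linarith

/-- As the gradient of the potential is `prox`, the derivative of `θ` is paired with `x'` alone, so
the Hessian enters only as a term bounded by `-c ‖x'‖²`. Monotonicity of the subgradients between
each proximal point and `xs` removes the remaining products with `θ` and `z - zs`. -/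
theorem hasDerivWithinAt_agentEnergy {β : ℝ} {f : Fin r → E → EReal} (hφ : ContDiff ℝ 2 φ)
    (hγ : 0 < γ) (hβ : 0 < β) (hβγ : (1 + γ) * β ≤ 2)
    (hc : ∀ a b, c * ‖a - b‖ ^ 2 ≤ inner ℝ (∇ φ a - ∇ φ b) (a - b))
    (hg : IsClosedProperConvex g) (hf : ∀ j, IsClosedProperConvex (f j))
    (hys : IsSubgradientAt g ys xs) (hzs : ∀ j, IsSubgradientAt (f j) (-(γ • zs j)) xs)
    (hlam : ys = -∇ φ xs + lam + γ • ∑ j, zs j) {x v : ℝ → E} {z : Fin r → ℝ → E} {v' : E}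
    {s : Set ℝ} {t : ℝ}
    (hx : HasDerivWithinAt x
      (prox g (x t - ∇ φ (x t) + v t + γ • ∑ j, z j t) - x t) s t)
    (hz : ∀ j, HasDerivWithinAt (z j) (prox (f j) (x t - γ • z j t) - x t) s t)
    (hv : HasDerivWithinAt v v' s t) :
    ∃ e', HasDerivWithinAt
        (fun τ => agentEnergy φ g γ xs ys zs (x τ) (fun j => z j τ) (v τ)) e' s t ∧
      e' ≤ -((c - 1 / 2 * (1 + γ) * r * (1 / β)) *
          (‖x t - xs‖ ^ 2 + ‖prox g (x t - ∇ φ (x t) + v t + γ • ∑ j, z j t) - x t‖ ^ 2))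
        + inner ℝ (v t - lam) (x t - xs)
        + inner ℝ v' (prox g (x t - ∇ φ (x t) + v t + γ • ∑ j, z j t) - x t) := by
  set θ := x t - ∇ φ (x t) + v t + γ • ∑ j, z j t with hθ
  set x' := prox g θ - x t with hx'
  set z' : Fin r → E := fun j => prox (f j) (x t - γ • z j t) - x t with hz'
  set H := fderiv ℝ (∇ φ) (x t) x' with hH
  have hp : prox g θ = x t + x' := by rw [hx']; abel
  have hq : ∀ j, prox (f j) (x t - γ • z j t) = x t + z' j := fun j => by simp [hz']
  have hG : HasDerivWithinAt (fun τ => ∇ φ (x τ)) H s t :=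
    ((contDiff_gradient hφ).differentiable one_ne_zero (x t)).hasFDerivAt.comp_hasDerivWithinAt t hx
  set θ' := x' - H + v' + γ • ∑ j, z' j with hθ'
  have hΘ : HasDerivWithinAt (fun τ => x τ - ∇ φ (x τ) + v τ + γ • ∑ j, z j τ) θ' s t :=
    ((hx.fun_sub hG).fun_add hv).fun_add ((HasDerivWithinAt.fun_sum fun j _ => hz j).const_smul γ)
  have hP : HasDerivWithinAt
      (fun τ => proxPotential g (x τ - ∇ φ (x τ) + v τ + γ • ∑ j, z j τ))
      (inner ℝ (x t + x') θ') s t := by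
    have := (hg.hasFDerivAt_proxPotential θ).comp_hasDerivWithinAt t hΘ
    rw [hp] at this
    exact this
  have hxs : HasDerivWithinAt (fun τ => x τ - xs) x' s t := hx.sub_const xs
  refine ⟨_, (((((hP.fun_sub (hx.inner ℝ hΘ)).fun_add (hx.norm_sq.const_mul (1 / 2))).fun_add
    (hxs.norm_sq.const_mul (1 / 2))).fun_add
      ((hasDerivWithinAt_const t s ys).inner ℝ hxs)).add_const
    ((g xs).toReal)).fun_add ((HasDerivWithinAt.fun_sum (u := Finset.univ) fun j _ =>
      ((hz j).sub_const (zs j)).norm_sq).const_mul (γ / 2)), ?_⟩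
  have hA := (hg.isSubgradientAt_prox θ).monotone hys
  have hB : ∀ j, 0 ≤ inner ℝ (-(z' j) - γ • (z j t - zs j)) (x t - xs + z' j) := fun j => by
    have := ((hf j).isSubgradientAt_prox (x t - γ • z j t)).monotone (hzs j)
    rw [hq] at this
    convert this using 2
    · module
    · abel
  have hBsum := Finset.sum_nonneg fun j (_ : j ∈ Finset.univ) => hB j
  rw [hp, show θ - (x t + x') - ys = (θ - x t - ys) - x' by abel,
    show x t + x' - xs = (x t - xs) + x' by abel] at hA
  have he : θ - x t - ys = -(∇ φ (x t) - ∇ φ xs) + (v t - lam) + γ • ∑ j, (z j t - zs j) := by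
    rw [hθ, hlam, Finset.sum_sub_distrib]
    module
  have h1 := hc (x t) xs
  have h2 := hessian_lower_bound hφ hc (x t) x'
  rw [← hH] at h2
  -- Young's inequality with weight `β`; `(1 + γ) * β ≤ 2` is exactly what lets `‖z' j‖ ^ 2` absorb
  -- both products.
  have hY : ∀ j, γ * inner ℝ x' (z' j) - inner ℝ (x t - xs) (z' j) - ‖z' j‖ ^ 2 ≤
      1 / (2 * β) * ‖x t - xs‖ ^ 2 + γ * (1 / (2 * β)) * ‖x'‖ ^ 2 := fun j => by
    have a1 : ∀ a : E, inner ℝ a (z' j) ≤ 1 / (2 * β) * ‖a‖ ^ 2 + β / 2 * ‖z' j‖ ^ 2 := by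
      intro a
      have b1 : 1 / (2 * β) * ‖a‖ ^ 2 + β / 2 * ‖z' j‖ ^ 2 - ‖a‖ * ‖z' j‖ =
          1 / (2 * β) * (‖a‖ - β * ‖z' j‖) ^ 2 := by
        field_simp
        ring
      have b2 : 0 ≤ 1 / (2 * β) * (‖a‖ - β * ‖z' j‖) ^ 2 := by positivity
      linarith [real_inner_le_norm a (z' j)]
    have a2 := mul_le_mul_of_nonneg_left (a1 x') hγ.le
    have a3 := a1 (-(x t - xs))
    rw [inner_neg_left, norm_neg] at a3
    have a4 : (1 + γ) * β / 2 * ‖z' j‖ ^ 2 ≤ 1 * ‖z' j‖ ^ 2 :=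
      mul_le_mul_of_nonneg_right (by linarith) (sq_nonneg _)
    linarith
  have hYsum := Finset.sum_le_sum fun j (_ : j ∈ Finset.univ) => hY j
  rw [Finset.sum_const, Finset.card_univ, Fintype.card_fin, nsmul_eq_mul] at hYsum
  have hθx : inner ℝ x' θ' =
      ‖x'‖ ^ 2 - inner ℝ x' H + inner ℝ v' x' + γ * ∑ j, inner ℝ x' (z' j) := by
    rw [hθ', inner_add_right, inner_add_right, inner_sub_right, real_inner_self_eq_norm_sq,
      inner_smul_right, inner_sum, real_inner_comm x' v']
  have heA : inner ℝ (θ - x t - ys) (x t - xs) = -inner ℝ (∇ φ (x t) - ∇ φ xs) (x t - xs)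
      + inner ℝ (v t - lam) (x t - xs) + γ * ∑ j, inner ℝ (z j t - zs j) (x t - xs) := by
    rw [he, inner_add_left, inner_add_left, inner_neg_left, real_inner_smul_left, sum_inner]
  have hBexp : ∀ j, inner ℝ (-(z' j) - γ • (z j t - zs j)) (x t - xs + z' j) =
      -inner ℝ (x t - xs) (z' j) - ‖z' j‖ ^ 2 - γ * inner ℝ (z j t - zs j) (x t - xs)
      - γ * inner ℝ (z j t - zs j) (z' j) := fun j => by
    rw [inner_add_right, inner_sub_left, inner_sub_left, inner_neg_left, inner_neg_left,
      real_inner_smul_left, real_inner_smul_left, real_inner_self_eq_norm_sq,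
      real_inner_comm (x t - xs) (z' j)]
    ring
  simp only [hBexp, Finset.sum_sub_distrib, ← Finset.mul_sum, Finset.sum_neg_distrib] at hBsum
  simp only [Finset.sum_sub_distrib, ← Finset.mul_sum] at hYsum
  rw [inner_sub_left, inner_add_right, inner_add_right, heA, real_inner_self_eq_norm_sq] at hA
  have hx1 : inner ℝ (θ - x t - ys) x' = inner ℝ x' θ - inner ℝ x' (x t) - inner ℝ ys x' := by
    rw [inner_sub_left, inner_sub_left, real_inner_comm x' θ, real_inner_comm x' (x t)]
  have hr : (r : ℝ) * (1 / (2 * β) * ‖x t - xs‖ ^ 2 + γ * (1 / (2 * β)) * ‖x'‖ ^ 2) ≤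
      1 / 2 * (1 + γ) * r * (1 / β) * (‖x t - xs‖ ^ 2 + ‖x'‖ ^ 2) := by
    have : 1 / 2 * (1 + γ) * r * (1 / β) * (‖x t - xs‖ ^ 2 + ‖x'‖ ^ 2) -
        (r : ℝ) * (1 / (2 * β) * ‖x t - xs‖ ^ 2 + γ * (1 / (2 * β)) * ‖x'‖ ^ 2) =
        r * (1 / (2 * β)) * (γ * ‖x t - xs‖ ^ 2 + ‖x'‖ ^ 2) := by
      field_simp
      ring
    have h0 : 0 ≤ r * (1 / (2 * β)) * (γ * ‖x t - xs‖ ^ 2 + ‖x'‖ ^ 2) := by positivity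
    linarith
  simp only [inner_zero_left, add_zero]
  rw [inner_add_left, hθx, ← Finset.mul_sum, real_inner_comm x' (x t)]
  have hx2 : inner ℝ x' (x t - xs) = inner ℝ (x t - xs) x' := real_inner_comm _ _
  rw [hx1, hx2] at hA
  rw [← hθ, show ∑ j, inner ℝ (z j t - zs j) (prox (f j) (x t - γ • z j t) - x t) =
    ∑ j, inner ℝ (z j t - zs j) (z' j) from rfl]
  linarith

end Agent

/-! ### The Lyapunov function of the multi-proximal dynamics -/

section Dynamics

variable {n q r : ℕ}

/-- The phase space of the dynamics; its points are the quadruples `(x, z, v, w)`. -/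
abbrev PhaseSpace (n q r : ℕ) : Type :=
  (Fin n → EuclideanSpace ℝ (Fin q)) × (Fin r → Fin n → EuclideanSpace ℝ (Fin q)) ×
    (Fin n → EuclideanSpace ℝ (Fin q)) × (Fin n → EuclideanSpace ℝ (Fin q))

/-- The vector field of the multi-proximal primal-dual dynamics. -/
def vectorField (G : WeightedDigraph n) (h : Fin n → ℝ) (α γ : ℝ)
    (f0 : Fin n → EuclideanSpace ℝ (Fin q) → ℝ)
    (f : Fin n → Fin (r + 1) → EuclideanSpace ℝ (Fin q) → EReal)
    (d : Fin n → EuclideanSpace ℝ (Fin q)) (u : PhaseSpace n q r) : PhaseSpace n q r :=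
  (fun i => prox (f i (Fin.last r)) (u.1 i - ∇ (f0 i) (u.1 i) + u.2.2.1 i + γ • ∑ j, u.2.1 j i)
      - u.1 i,
    fun j i => prox (f i j.castSucc) (u.1 i - γ • u.2.1 j i) - u.1 i,
    fun i => -((h i)⁻¹ • (u.1 i - d i)) - α • ∑ k, G.laplacian i k • u.2.2.1 k - u.2.2.2 i,
    fun i => α • ∑ k, G.laplacian i k • u.2.2.1 k)

variable {G : WeightedDigraph n} {h : Fin n → ℝ} {α γ : ℝ}
  {f0 : Fin n → EuclideanSpace ℝ (Fin q) → ℝ}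
  {f : Fin n → Fin (r + 1) → EuclideanSpace ℝ (Fin q) → EReal}
  {d : Fin n → EuclideanSpace ℝ (Fin q)}

theorem hasDerivWithinAt_prod_iff {X Y : Type*} [NormedAddCommGroup X] [NormedSpace ℝ X]
    [NormedAddCommGroup Y] [NormedSpace ℝ Y] {u : ℝ → X × Y} {u' : X × Y} {s : Set ℝ} {t : ℝ} :
    HasDerivWithinAt u u' s t ↔ HasDerivWithinAt (fun τ => (u τ).1) u'.1 s t ∧
      HasDerivWithinAt (fun τ => (u τ).2) u'.2 s t :=
  ⟨fun hu => ⟨(hasFDerivAt_fst (p := u t)).comp_hasDerivWithinAt t hu,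
    (hasFDerivAt_snd (p := u t)).comp_hasDerivWithinAt t hu⟩, fun hu => hu.1.prodMk hu.2⟩

theorem hasDerivWithinAt_phaseSpace_iff {u : ℝ → PhaseSpace n q r} {u' : PhaseSpace n q r}
    {s : Set ℝ} {t : ℝ} : HasDerivWithinAt u u' s t ↔
      (∀ i, HasDerivWithinAt (fun τ => (u τ).1 i) (u'.1 i) s t) ∧
      (∀ j i, HasDerivWithinAt (fun τ => (u τ).2.1 j i) (u'.2.1 j i) s t) ∧
      (∀ i, HasDerivWithinAt (fun τ => (u τ).2.2.1 i) (u'.2.2.1 i) s t) ∧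
      ∀ i, HasDerivWithinAt (fun τ => (u τ).2.2.2 i) (u'.2.2.2 i) s t := by
  simp only [hasDerivWithinAt_prod_iff, hasDerivWithinAt_pi]

theorem isTrajectory_iff {x : ℝ → Fin n → EuclideanSpace ℝ (Fin q)}
    {z : ℝ → Fin r → Fin n → EuclideanSpace ℝ (Fin q)}
    {v w : ℝ → Fin n → EuclideanSpace ℝ (Fin q)} :
    IsTrajectory G h α γ f0 f d x z v w ↔
      (∀ t, 0 ≤ t → HasDerivWithinAt (fun τ => ((x τ, z τ, v τ, w τ) : PhaseSpace n q r))
        (vectorField G h α γ f0 f d (x t, z t, v t, w t)) (Ici 0) t) ∧ w 0 = 0 := by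
  constructor
  · intro H
    exact ⟨fun t ht => hasDerivWithinAt_phaseSpace_iff.2
      ⟨H.deriv_x t ht, H.deriv_z t ht, H.deriv_v t ht, H.deriv_w t ht⟩, H.init_w⟩
  · rintro ⟨H, hw⟩
    exact ⟨fun t ht => (hasDerivWithinAt_phaseSpace_iff.1 (H t ht)).1,
      fun t ht => (hasDerivWithinAt_phaseSpace_iff.1 (H t ht)).2.1,
      fun t ht => (hasDerivWithinAt_phaseSpace_iff.1 (H t ht)).2.2.1,
      fun t ht => (hasDerivWithinAt_phaseSpace_iff.1 (H t ht)).2.2.2, hw⟩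

theorem locallyLipschitz_pi {X ι : Type*} [PseudoEMetricSpace X] [Fintype ι] {Y : ι → Type*}
    [∀ i, PseudoEMetricSpace (Y i)] {F : X → ∀ i, Y i}
    (hF : ∀ i, LocallyLipschitz fun x => F x i) : LocallyLipschitz F := by
  intro x
  choose K t ht hK using fun i => hF i x
  refine ⟨∑ i, K i, ⋂ i, t i, iInter_mem.2 ht, fun y hy y' hy' => edist_pi_le_iff.2 fun i => ?_⟩
  refine (hK i (mem_iInter.1 hy i) (mem_iInter.1 hy' i)).trans ?_
  gcongr
  exact Finset.single_le_sum (f := K) (fun _ _ => zero_le) (Finset.mem_univ i)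

theorem vectorField_locallyLipschitz (hf0 : ∀ i, ContDiff ℝ 2 (f0 i))
    (hf : ∀ i j, IsClosedProperConvex (f i j)) :
    LocallyLipschitz (vectorField G h α γ f0 f d) := by
  have hprox : ∀ i j, LocallyLipschitz (prox (f i j)) := fun i j =>
    (LipschitzWith.of_dist_le_mul (K := 1) fun a b => by
      simpa [dist_eq_norm] using (hf i j).norm_prox_sub_le a b).locallyLipschitz
  have hgrad := fun i => contDiff_gradient (hf0 i)
  refine LocallyLipschitz.prodMk ?_ (LocallyLipschitz.prodMk ?_ (LocallyLipschitz.prodMk ?_ ?_))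
  · refine locallyLipschitz_pi fun i => LocallyLipschitz.sub ((hprox i _).comp ?_) ?_
    · refine ContDiff.locallyLipschitz (𝕂 := ℝ) ?_
      have := hgrad i
      fun_prop
    · exact ContDiff.locallyLipschitz (𝕂 := ℝ) (by fun_prop)
  · refine locallyLipschitz_pi fun j => locallyLipschitz_pi fun i =>
      LocallyLipschitz.sub ((hprox i _).comp ?_) ?_
    · exact ContDiff.locallyLipschitz (𝕂 := ℝ) (by fun_prop)
    · exact ContDiff.locallyLipschitz (𝕂 := ℝ) (by fun_prop)
  · exact ContDiff.locallyLipschitz (𝕂 := ℝ) (by fun_prop)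
  · exact ContDiff.locallyLipschitz (𝕂 := ℝ) (by fun_prop)

end Dynamics

/-! ### Lyapunov function: coercivity and decay. -/

section Stability

variable {n q r : ℕ}

/-- The standing assumptions of the stability analysis: the problem data, the gains, and a point
satisfying the KKT conditions. -/
structure IsStableSetting (hn : 2 ≤ n) (G : WeightedDigraph n) (h : Fin n → ℝ) (α β γ η c K : ℝ)
    (f0 : Fin n → EuclideanSpace ℝ (Fin q) → ℝ)
    (f : Fin n → Fin (r + 1) → EuclideanSpace ℝ (Fin q) → EReal)
    (d xs : Fin n → EuclideanSpace ℝ (Fin q)) (lam : EuclideanSpace ℝ (Fin q))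
    (us : Fin n → Fin (r + 1) → EuclideanSpace ℝ (Fin q)) : Prop where
  connected : G.StronglyConnected
  perron : G.IsLeftPerron h
  smooth : ∀ i, ContDiff ℝ 2 (f0 i)
  strongly_monotone : ∀ i a b, c * ‖a - b‖ ^ 2 ≤ inner ℝ (∇ (f0 i) a - ∇ (f0 i) b) (a - b)
  closed : ∀ i j, IsClosedProperConvex (f i j)
  kkt : IsKKT f0 f d xs lam us
  γ_pos : 0 < γ
  β_pos : 0 < β
  βγ_le : (1 + γ) * β ≤ 2
  η_pos : 0 < η
  lt_α : (η + 1) ^ 2 / (η * secondSmallestEigenvalue hn (G.symLaplacian_isHermitian h)) < α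
  inv_le : ∀ i, (h i)⁻¹ ≤ K
  lt_dissipation : K < (η + 1) * (c - 1 / 2 * (1 + γ) * r * (1 / β))
  lt_coercivity : K < (η + 1) * (c - γ * r)

/-- The equilibrium of the dynamics which belongs to a KKT point. -/
def equilibrium (h : Fin n → ℝ) (γ : ℝ) (d xs : Fin n → EuclideanSpace ℝ (Fin q))
    (lam : EuclideanSpace ℝ (Fin q)) (us : Fin n → Fin (r + 1) → EuclideanSpace ℝ (Fin q)) :
    PhaseSpace n q r :=
  (xs, fun j i => -(γ⁻¹ • us i j.castSucc), fun _ => lam, fun i => -((h i)⁻¹ • (xs i - d i)))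

/-- The Lyapunov function of the dynamics. -/
def lyapunov (G : WeightedDigraph n) (h : Fin n → ℝ) (α γ η : ℝ)
    (f0 : Fin n → EuclideanSpace ℝ (Fin q) → ℝ)
    (f : Fin n → Fin (r + 1) → EuclideanSpace ℝ (Fin q) → EReal)
    (d xs : Fin n → EuclideanSpace ℝ (Fin q)) (lam : EuclideanSpace ℝ (Fin q))
    (us : Fin n → Fin (r + 1) → EuclideanSpace ℝ (Fin q)) (u : PhaseSpace n q r) : ℝ :=
  (η + 1) * ∑ i, agentEnergy (f0 i) (f i (Fin.last r)) γ (xs i) (us i (Fin.last r))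
      (fun j => (equilibrium h γ d xs lam us).2.1 j i) (u.1 i) (fun j => u.2.1 j i) (u.2.2.1 i)
    + 1 / 2 * ∑ i, h i * (η * ‖u.2.2.1 i - lam‖ ^ 2
      + ‖u.2.2.1 i - lam + (u.2.2.2 i - (equilibrium h γ d xs lam us).2.2.2 i)‖ ^ 2)
    + 1 / 2 * ∑ i, h i * (η * ‖(vectorField G h α γ f0 f d u).2.2.1 i‖ ^ 2
      + ‖(vectorField G h α γ f0 f d u).2.2.1 i + (vectorField G h α γ f0 f d u).2.2.2 i‖ ^ 2)

variable {hn : 2 ≤ n} {G : WeightedDigraph n} {h : Fin n → ℝ} {α β γ η c K : ℝ}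
  {f0 : Fin n → EuclideanSpace ℝ (Fin q) → ℝ}
  {f : Fin n → Fin (r + 1) → EuclideanSpace ℝ (Fin q) → EReal}
  {d xs : Fin n → EuclideanSpace ℝ (Fin q)} {lam : EuclideanSpace ℝ (Fin q)}
  {us : Fin n → Fin (r + 1) → EuclideanSpace ℝ (Fin q)}

namespace IsStableSetting

/-- The consensus estimate for deviations from equilibrium. The weighted sum of the `w` deviation
vanishes because `xs` satisfies the resource constraint. -/
theorem dissipation_at (S : IsStableSetting hn G h α β γ η c K f0 f d xs lam us)
    {u : PhaseSpace n q r} (hw : ∑ i, h i • u.2.2.2 i = 0) :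
    ∑ i, h i * (η * inner ℝ (u.2.2.1 i - lam) ((vectorField G h α γ f0 f d u).2.2.1 i)
      + inner ℝ (u.2.2.1 i - lam + (u.2.2.2 i - (equilibrium h γ d xs lam us).2.2.2 i))
        ((vectorField G h α γ f0 f d u).2.2.1 i + (vectorField G h α γ f0 f d u).2.2.2 i)) ≤
    -(η + 1) * ∑ i, inner ℝ (u.2.2.1 i - lam) (u.1 i - xs i) + K * ∑ i, ‖u.1 i - xs i‖ ^ 2
      - 1 / 2 * ∑ i, h i * ‖u.2.2.2 i - (equilibrium h γ d xs lam us).2.2.2 i‖ ^ 2 := by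
  refine S.perron.dissipation S.connected hn S.η_pos S.lt_α S.inv_le (fun i => u.1 i - xs i)
    (fun i => u.2.2.1 i - lam) (fun i => u.2.2.2 i - (equilibrium h γ d xs lam us).2.2.2 i)
    (fun i => (vectorField G h α γ f0 f d u).2.2.1 i)
    (fun i => (vectorField G h α γ f0 f d u).2.2.2 i) ?_ (fun i => ?_) (fun i => ?_)
  · have h1 : ∀ i, h i • (u.2.2.2 i - (equilibrium h γ d xs lam us).2.2.2 i) =
        h i • u.2.2.2 i + (xs i - d i) := fun i => by
      simp only [equilibrium, sub_neg_eq_add, smul_add, smul_smul,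
        mul_inv_cancel₀ (S.perron.pos i).ne', one_smul]
    simp only [h1, Finset.sum_add_distrib, Finset.sum_sub_distrib, hw, S.kkt.sum_eq, sub_self,
      add_zero]
  · simp only [vectorField, smul_sub, Finset.sum_sub_distrib,
      WeightedDigraph.sum_laplacian_smul_const, sub_zero]
  · simp only [vectorField, equilibrium]
    module

/-- The consensus estimate for velocities: in its use `V`, `X`, `A` are `v̇`, `ẋ`, `v̈`. The
weighted sum of `ẇ` vanishes at every state, as `h` kills the range of the Laplacian. -/
theorem dissipation_deriv (S : IsStableSetting hn G h α β γ η c K f0 f d xs lam us)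
    (u : PhaseSpace n q r) {X V W A : Fin n → EuclideanSpace ℝ (Fin q)}
    (hW : W = (vectorField G h α γ f0 f d u).2.2.2)
    (hA : ∀ i, A i = -((h i)⁻¹ • X i) - α • ∑ k, G.laplacian i k • V k - W i) :
    ∑ i, h i * (η * inner ℝ (V i) (A i)
      + inner ℝ (V i + W i) (A i + α • ∑ k, G.laplacian i k • V k)) ≤
    -(η + 1) * ∑ i, inner ℝ (V i) (X i) + K * ∑ i, ‖X i‖ ^ 2 := by
  have h1 := S.perron.dissipation S.connected hn S.η_pos S.lt_α S.inv_le X V W A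
    (fun i => α • ∑ k, G.laplacian i k • V k) (by
      rw [hW]
      have := congrArg (α • ·) (S.perron.sum_smul_laplacian u.2.2.1)
      simp only [smul_zero, Finset.smul_sum (r := α)] at this
      rw [← this]
      refine Finset.sum_congr rfl fun i _ => ?_
      exact smul_comm _ _ _) (fun i => rfl) hA
  have h2 : 0 ≤ ∑ i, h i * ‖W i‖ ^ 2 :=
    Finset.sum_nonneg fun i _ => mul_nonneg (S.perron.pos i).le (sq_nonneg _)
  linarith

theorem subgradient_last (S : IsStableSetting hn G h α β γ η c K f0 f d xs lam us) (i : Fin n) :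
    us i (Fin.last r) = -∇ (f0 i) (xs i) + lam
      + γ • ∑ j, (equilibrium h γ d xs lam us).2.1 j i := by
  have h1 := S.kkt.stationary i
  rw [Fin.sum_univ_castSucc] at h1
  simp only [equilibrium, Finset.sum_neg_distrib, smul_neg, ← Finset.smul_sum, smul_smul,
    mul_inv_cancel₀ S.γ_pos.ne', one_smul]
  rw [← h1]
  abel

/-- `dissipation_at` trades the indefinite product of `v - lam` and `x - xs` for products of
deviations with velocities, which the two quadratic forms complete to squares. In the second square
the Laplacian and `w` cancel, leaving `v - lam - h⁻¹ (x - xs)`. -/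
theorem le_lyapunov (S : IsStableSetting hn G h α β γ η c K f0 f d xs lam us)
    {u : PhaseSpace n q r} (hw : ∑ i, h i • u.2.2.2 i = 0) :
    ((η + 1) * (c - γ * r) - K) * ∑ i, ‖u.1 i - xs i‖ ^ 2
      + (η + 1) * (γ / 4) * ∑ i, ∑ j, ‖u.2.1 j i - (equilibrium h γ d xs lam us).2.1 j i‖ ^ 2
      + 1 / 2 * ∑ i, h i * ‖u.2.2.1 i - lam - (h i)⁻¹ • (u.1 i - xs i)‖ ^ 2
      + 1 / 2 * ∑ i, h i * ‖u.2.2.2 i - (equilibrium h γ d xs lam us).2.2.2 i‖ ^ 2 ≤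
    lyapunov G h α γ η f0 f d xs lam us u := by
  have hη := S.η_pos
  have h1 := Finset.sum_le_sum fun i (_ : i ∈ Finset.univ) =>
    le_agentEnergy S.γ_pos (S.strongly_monotone i) (S.closed i (Fin.last r))
      (S.kkt.subgradient i (Fin.last r)) (S.subgradient_last i) (u.1 i) (fun j => u.2.1 j i)
      (u.2.2.1 i)
  simp only [Finset.sum_add_distrib, Finset.sum_sub_distrib, ← Finset.mul_sum] at h1
  have h2 := mul_le_mul_of_nonneg_left h1 (show 0 ≤ η + 1 by linarith)
  have h3 := S.dissipation_at hw
  unfold lyapunov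
  have h4 : ∀ i, 1 / 2 * (h i * ‖u.2.2.1 i - lam - (h i)⁻¹ • (u.1 i - xs i)‖ ^ 2) ≤
      h i * (η * inner ℝ (u.2.2.1 i - lam) ((vectorField G h α γ f0 f d u).2.2.1 i)
      + inner ℝ (u.2.2.1 i - lam + (u.2.2.2 i - (equilibrium h γ d xs lam us).2.2.2 i))
        ((vectorField G h α γ f0 f d u).2.2.1 i + (vectorField G h α γ f0 f d u).2.2.2 i))
      + 1 / 2 * (h i * (η * ‖u.2.2.1 i - lam‖ ^ 2
      + ‖u.2.2.1 i - lam + (u.2.2.2 i - (equilibrium h γ d xs lam us).2.2.2 i)‖ ^ 2))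
      + 1 / 2 * (h i * (η * ‖(vectorField G h α γ f0 f d u).2.2.1 i‖ ^ 2
      + ‖(vectorField G h α γ f0 f d u).2.2.1 i
        + (vectorField G h α γ f0 f d u).2.2.2 i‖ ^ 2)) := by
    intro i
    have e : u.2.2.1 i - lam - (h i)⁻¹ • (u.1 i - xs i) =
        (u.2.2.1 i - lam + (u.2.2.2 i - (equilibrium h γ d xs lam us).2.2.2 i)) +
        ((vectorField G h α γ f0 f d u).2.2.1 i + (vectorField G h α γ f0 f d u).2.2.2 i) := by
      simp only [vectorField, equilibrium]
      module
    rw [e, norm_add_sq_real (u.2.2.1 i - lam + _)]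
    have h5 : 0 ≤ h i * (η *
        ‖u.2.2.1 i - lam + (vectorField G h α γ f0 f d u).2.2.1 i‖ ^ 2) :=
      mul_nonneg (S.perron.pos i).le (mul_nonneg hη.le (sq_nonneg _))
    rw [norm_add_sq_real (u.2.2.1 i - lam)] at h5
    linarith
  have h6 := Finset.sum_le_sum fun i (_ : i ∈ Finset.univ) => h4 i
  simp only [Finset.sum_add_distrib, ← Finset.mul_sum] at h6
  linarith

theorem hasDerivWithinAt_agentEnergy_at
    (S : IsStableSetting hn G h α β γ η c K f0 f d xs lam us)
    {u : ℝ → PhaseSpace n q r} {s : Set ℝ} {t : ℝ}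
    (hu : HasDerivWithinAt u (vectorField G h α γ f0 f d (u t)) s t) (i : Fin n) :
    ∃ e', HasDerivWithinAt (fun τ => agentEnergy (f0 i) (f i (Fin.last r)) γ (xs i)
      (us i (Fin.last r)) (fun j => (equilibrium h γ d xs lam us).2.1 j i) ((u τ).1 i)
      (fun j => (u τ).2.1 j i) ((u τ).2.2.1 i)) e' s t ∧
      e' ≤ -((c - 1 / 2 * (1 + γ) * r * (1 / β)) *
          (‖(u t).1 i - xs i‖ ^ 2 + ‖(vectorField G h α γ f0 f d (u t)).1 i‖ ^ 2))
        + inner ℝ ((u t).2.2.1 i - lam) ((u t).1 i - xs i)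
        + inner ℝ ((vectorField G h α γ f0 f d (u t)).2.2.1 i)
          ((vectorField G h α γ f0 f d (u t)).1 i) := by
  obtain ⟨hx, hz, hv, -⟩ := hasDerivWithinAt_phaseSpace_iff.1 hu
  have hzs : ∀ j, IsSubgradientAt (f i (Fin.castSucc j))
      (-(γ • (equilibrium h γ d xs lam us).2.1 j i)) (xs i) := fun j => by
    have : -(γ • (equilibrium h γ d xs lam us).2.1 j i) = us i j.castSucc := by
      simp only [equilibrium, smul_neg, neg_neg, smul_smul, mul_inv_cancel₀ S.γ_pos.ne', one_smul]
    rw [this]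
    exact S.kkt.subgradient i j.castSucc
  exact hasDerivWithinAt_agentEnergy (x := fun τ => (u τ).1 i) (v := fun τ => (u τ).2.2.1 i)
    (z := fun j τ => (u τ).2.1 j i) (f := fun j => f i (Fin.castSucc j))
    (S.smooth i) S.γ_pos S.β_pos S.βγ_le
    (S.strongly_monotone i) (S.closed i (Fin.last r)) (fun j => S.closed i (Fin.castSucc j))
    (S.kkt.subgradient i (Fin.last r)) hzs (S.subgradient_last i) (hx i) (fun j => hz j i) (hv i)

/-- The supply terms of the agents, scaled by `η + 1`, cancel against `dissipation_at` and
`dissipation_deriv`; what is left in `‖ẋ‖²` is nonpositive and dropped. -/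
theorem hasDerivWithinAt_lyapunov (S : IsStableSetting hn G h α β γ η c K f0 f d xs lam us)
    {u : ℝ → PhaseSpace n q r} {s : Set ℝ} {t : ℝ}
    (hu : HasDerivWithinAt u (vectorField G h α γ f0 f d (u t)) s t)
    (hw : ∑ i, h i • (u t).2.2.2 i = 0) :
    ∃ V', HasDerivWithinAt (fun τ => lyapunov G h α γ η f0 f d xs lam us (u τ)) V' s t ∧
      V' ≤ -(((η + 1) * (c - 1 / 2 * (1 + γ) * r * (1 / β)) - K) *
        ∑ i, ‖(u t).1 i - xs i‖ ^ 2) := by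
  obtain ⟨hx, -, hv, hw'⟩ := hasDerivWithinAt_phaseSpace_iff.1 hu
  have hη := S.η_pos
  choose e' he' hele using S.hasDerivWithinAt_agentEnergy_at hu
  set A : Fin n → EuclideanSpace ℝ (Fin q) := (vectorField G h α γ f0 f d (u t)).2.2.1
  set B : Fin n → EuclideanSpace ℝ (Fin q) := (vectorField G h α γ f0 f d (u t)).2.2.2
  set X : Fin n → EuclideanSpace ℝ (Fin q) := (vectorField G h α γ f0 f d (u t)).1
  have hBd : ∀ i, HasDerivWithinAt (fun τ => (vectorField G h α γ f0 f d (u τ)).2.2.2 i)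
      (α • ∑ k, G.laplacian i k • A k) s t := fun i =>
    (HasDerivWithinAt.fun_sum fun k _ => (hv k).const_smul (G.laplacian i k)).const_smul α
  have hAd : ∀ i, HasDerivWithinAt (fun τ => (vectorField G h α γ f0 f d (u τ)).2.2.1 i)
      (-((h i)⁻¹ • X i) - α • ∑ k, G.laplacian i k • A k - B i) s t := fun i =>
    ((((hx i).sub_const (d i)).const_smul (h i)⁻¹).fun_neg.fun_sub (hBd i)).fun_sub (hw' i)
  have hvl : ∀ i, HasDerivWithinAt (fun τ => (u τ).2.2.1 i - lam) (A i) s t := fun i =>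
    (hv i).sub_const lam
  have hwl : ∀ i, HasDerivWithinAt (fun τ => (u τ).2.2.1 i - lam
      + ((u τ).2.2.2 i - (equilibrium h γ d xs lam us).2.2.2 i)) (A i + B i) s t := fun i =>
    (hvl i).fun_add ((hw' i).sub_const _)
  have hE := HasDerivWithinAt.fun_sum (u := Finset.univ) fun i _ => he' i
  have hP : HasDerivWithinAt (fun τ => ∑ i, h i * (η * ‖(u τ).2.2.1 i - lam‖ ^ 2
      + ‖(u τ).2.2.1 i - lam + ((u τ).2.2.2 i - (equilibrium h γ d xs lam us).2.2.2 i)‖ ^ 2))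
      (∑ i, h i * (η * (2 * inner ℝ ((u t).2.2.1 i - lam) (A i)) + 2 * inner ℝ ((u t).2.2.1 i - lam
        + ((u t).2.2.2 i - (equilibrium h γ d xs lam us).2.2.2 i)) (A i + B i))) s t :=
    HasDerivWithinAt.fun_sum fun i _ =>
      (((hvl i).norm_sq.const_mul η).fun_add (hwl i).norm_sq).const_mul (h i)
  have hQ : HasDerivWithinAt
      (fun τ => ∑ i, h i * (η * ‖(vectorField G h α γ f0 f d (u τ)).2.2.1 i‖ ^ 2
      + ‖(vectorField G h α γ f0 f d (u τ)).2.2.1 i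
        + (vectorField G h α γ f0 f d (u τ)).2.2.2 i‖ ^ 2))
      (∑ i, h i * (η * (2 * inner ℝ (A i)
        (-((h i)⁻¹ • X i) - α • ∑ k, G.laplacian i k • A k - B i)) +
        2 * inner ℝ (A i + B i) (-((h i)⁻¹ • X i) - α • ∑ k, G.laplacian i k • A k - B i
          + α • ∑ k, G.laplacian i k • A k))) s t :=
    HasDerivWithinAt.fun_sum fun i _ =>
      (((hAd i).norm_sq.const_mul η).fun_add ((hAd i).fun_add (hBd i)).norm_sq).const_mul (h i)
  refine ⟨_, ((hE.const_mul (η + 1)).fun_add (hP.const_mul (1 / 2))).fun_add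
    (hQ.const_mul (1 / 2)), ?_⟩
  have h1 : ∑ i, h i * (η * inner ℝ ((u t).2.2.1 i - lam) (A i) + inner ℝ ((u t).2.2.1 i - lam
        + ((u t).2.2.2 i - (equilibrium h γ d xs lam us).2.2.2 i)) (A i + B i)) ≤
      -(η + 1) * ∑ i, inner ℝ ((u t).2.2.1 i - lam) ((u t).1 i - xs i)
      + K * ∑ i, ‖(u t).1 i - xs i‖ ^ 2 - 1 / 2 * ∑ i, h i *
        ‖(u t).2.2.2 i - (equilibrium h γ d xs lam us).2.2.2 i‖ ^ 2 := S.dissipation_at hw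
  have hW : 0 ≤ ∑ i, h i * ‖(u t).2.2.2 i - (equilibrium h γ d xs lam us).2.2.2 i‖ ^ 2 :=
    Finset.sum_nonneg fun i _ => mul_nonneg (S.perron.pos i).le (sq_nonneg _)
  have h2 := S.dissipation_deriv (u t) (X := X) (V := A) (W := B) rfl (fun i => rfl)
  have h3 := mul_le_mul_of_nonneg_left
    (Finset.sum_le_sum fun i (_ : i ∈ Finset.univ) => hele i) (show 0 ≤ η + 1 by linarith)
  simp only [Finset.sum_add_distrib, Finset.sum_neg_distrib, ← Finset.mul_sum] at h3
  have h4 : 0 ≤ ((η + 1) * (c - 1 / 2 * (1 + γ) * r * (1 / β)) - K) * ∑ i, ‖X i‖ ^ 2 :=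
    mul_nonneg (by linarith [S.lt_dissipation]) (Finset.sum_nonneg fun i _ => sq_nonneg _)
  have e2 : ∀ a b : Fin n → ℝ, 1 / 2 * ∑ i, h i * (η * (2 * a i) + 2 * b i) =
      ∑ i, h i * (η * a i + b i) := fun a b => by
    rw [Finset.mul_sum]
    refine Finset.sum_congr rfl fun i _ => ?_
    ring
  rw [e2, e2]
  linarith

end IsStableSetting

end Stability

/-! ### Boundedness, global existence and convergence of trajectories. -/

section Convergence

variable {n q r : ℕ} {hn : 2 ≤ n} {G : WeightedDigraph n} {h : Fin n → ℝ} {α β γ η c K : ℝ}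
  {f0 : Fin n → EuclideanSpace ℝ (Fin q) → ℝ}
  {f : Fin n → Fin (r + 1) → EuclideanSpace ℝ (Fin q) → EReal}
  {d xs : Fin n → EuclideanSpace ℝ (Fin q)} {lam : EuclideanSpace ℝ (Fin q)}
  {us : Fin n → Fin (r + 1) → EuclideanSpace ℝ (Fin q)}

namespace IsStableSetting

theorem sum_smul_eq_zero (S : IsStableSetting hn G h α β γ η c K f0 f d xs lam us)
    {u : ℝ → PhaseSpace n q r} {s : Set ℝ} (hs : Convex ℝ s) (h0 : (0 : ℝ) ∈ s)
    (hu : ∀ t ∈ s, HasDerivWithinAt u (vectorField G h α γ f0 f d (u t)) s t)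
    (hw : (u 0).2.2.2 = 0) {t : ℝ} (ht : t ∈ s) : ∑ i, h i • (u t).2.2.2 i = 0 := by
  have hd : ∀ τ ∈ s, HasDerivWithinAt (fun τ => ∑ i, h i • (u τ).2.2.2 i) 0 s τ := by
    intro τ hτ
    have h1 := (hasDerivWithinAt_phaseSpace_iff.1 (hu τ hτ)).2.2.2
    refine (HasDerivWithinAt.fun_sum fun i _ => (h1 i).const_smul (h i)).congr_deriv ?_
    have h2 := congrArg (α • ·) (S.perron.sum_smul_laplacian (u τ).2.2.1)
    simp only [smul_zero, Finset.smul_sum (r := α)] at h2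
    rw [← h2]
    exact Finset.sum_congr rfl fun i _ => smul_comm _ _ _
  have h1 := hs.norm_image_sub_le_of_norm_hasDerivWithin_le (C := 0) hd (by simp) h0 ht
  rw [zero_mul, norm_le_zero_iff, sub_eq_zero] at h1
  rw [h1, hw]
  simp

theorem antitoneOn_lyapunov (S : IsStableSetting hn G h α β γ η c K f0 f d xs lam us)
    {u : ℝ → PhaseSpace n q r} {s : Set ℝ} (hs : Convex ℝ s) (h0 : (0 : ℝ) ∈ s)
    (hu : ∀ t ∈ s, HasDerivWithinAt u (vectorField G h α γ f0 f d (u t)) s t)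
    (hw : (u 0).2.2.2 = 0) :
    AntitoneOn (fun τ => lyapunov G h α γ η f0 f d xs lam us (u τ)) s := by
  choose! V' hV' hle using fun t (ht : t ∈ s) =>
    S.hasDerivWithinAt_lyapunov (hu t ht) (S.sum_smul_eq_zero hs h0 hu hw ht)
  refine antitoneOn_of_hasDerivWithinAt hs hV' fun t ht => (hle t ht).trans ?_
  exact neg_nonpos.2 (mul_nonneg (by linarith [S.lt_dissipation])
    (Finset.sum_nonneg fun i _ => sq_nonneg _))

theorem exists_norm_le (S : IsStableSetting hn G h α β γ η c K f0 f d xs lam us) (M : ℝ) :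
    ∃ R, ∀ u : PhaseSpace n q r, ∑ i, h i • u.2.2.2 i = 0 →
      lyapunov G h α γ η f0 f d xs lam us u ≤ M → ‖u‖ ≤ R := by
  set E := equilibrium h γ d xs lam us with hE
  set κ₁ := (η + 1) * (c - γ * r) - K with hκ₁
  have hκ₁0 : 0 < κ₁ := by linarith [S.lt_coercivity]
  set κ₂ := (η + 1) * (γ / 4) with hκ₂
  have hκ₂0 : 0 < κ₂ := mul_pos (by linarith [S.η_pos]) (by linarith [S.γ_pos])
  have hi0 : 0 < n := by omega
  have hK0 : 0 < K := (inv_pos.2 (S.perron.pos ⟨0, hi0⟩)).trans_le (S.inv_le _)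
  -- Because `a ≤ 1 + a ^ 2`, the leading `1` avoids square roots. The other terms serve `x`, `z`
  -- and the two `h`-weighted squares.
  set ρ := 1 + (|M| / κ₁ + |M| / κ₂ + 2 * |M| * K) with hρ
  have hρ0 : 0 ≤ ρ := by positivity
  have hsq : ∀ {a κ : ℝ}, 0 < κ → κ * a ^ 2 ≤ |M| → 1 + |M| / κ ≤ ρ → a ≤ ρ := by
    intro a κ hκ h1 h2
    refine le_trans ?_ h2
    have h3 : a ^ 2 ≤ |M| / κ := by rwa [le_div_iff₀ hκ, mul_comm]
    nlinarith [sq_nonneg (a - 1)]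
  refine ⟨ρ * (1 + K) + ‖E‖, fun u hw hu => ?_⟩
  have hlow := S.le_lyapunov hw
  rw [← hκ₁, ← hκ₂, ← hE] at hlow
  have p1 : 0 ≤ κ₁ * ∑ i, ‖u.1 i - xs i‖ ^ 2 :=
    mul_nonneg hκ₁0.le (Finset.sum_nonneg fun i _ => sq_nonneg _)
  have p2 : 0 ≤ κ₂ * ∑ i, ∑ j, ‖u.2.1 j i - E.2.1 j i‖ ^ 2 :=
    mul_nonneg hκ₂0.le (Finset.sum_nonneg fun i _ => Finset.sum_nonneg fun j _ => sq_nonneg _)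
  have p3 : 0 ≤ ∑ i, h i * ‖u.2.2.1 i - lam - (h i)⁻¹ • (u.1 i - xs i)‖ ^ 2 :=
    Finset.sum_nonneg fun i _ => mul_nonneg (S.perron.pos i).le (sq_nonneg _)
  have p4 : 0 ≤ ∑ i, h i * ‖u.2.2.2 i - E.2.2.2 i‖ ^ 2 :=
    Finset.sum_nonneg fun i _ => mul_nonneg (S.perron.pos i).le (sq_nonneg _)
  have hM := le_abs_self M
  have q0 : 0 ≤ |M| / κ₁ := by positivity
  have q1 : 0 ≤ |M| / κ₂ := by positivity
  have q2 : 0 ≤ 2 * |M| * K := by positivity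
  have hhalf : ∀ i, 0 < 1 / 2 * h i := fun i => by linarith [S.perron.pos i]
  have hhρ : ∀ i, 1 + |M| / (1 / 2 * h i) ≤ ρ := fun i => by
    have h1 : |M| / (1 / 2 * h i) = 2 * |M| * (h i)⁻¹ := by
      have := (S.perron.pos i).ne'
      field_simp
    have h2 : 2 * |M| * (h i)⁻¹ ≤ 2 * |M| * K :=
      mul_le_mul_of_nonneg_left (S.inv_le i) (by positivity)
    rw [h1, hρ]
    linarith
  have b1 : ∀ i, ‖u.1 i - xs i‖ ≤ ρ := fun i => by
    refine hsq hκ₁0 ?_ (by rw [hρ]; linarith)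
    have h1 := Finset.single_le_sum (f := fun i => ‖u.1 i - xs i‖ ^ 2)
      (fun i _ => sq_nonneg _) (Finset.mem_univ i)
    have h2 := mul_le_mul_of_nonneg_left h1 hκ₁0.le
    linarith
  have b2 : ∀ j i, ‖u.2.1 j i - E.2.1 j i‖ ≤ ρ := fun j i => by
    refine hsq hκ₂0 ?_ (by rw [hρ]; linarith)
    have h1 := Finset.single_le_sum (f := fun j => ‖u.2.1 j i - E.2.1 j i‖ ^ 2)
      (fun i _ => sq_nonneg _) (Finset.mem_univ j)
    have h2 := Finset.single_le_sum (f := fun i => ∑ j, ‖u.2.1 j i - E.2.1 j i‖ ^ 2)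
      (fun i _ => Finset.sum_nonneg fun j _ => sq_nonneg _) (Finset.mem_univ i)
    have h3 := mul_le_mul_of_nonneg_left (h1.trans h2) hκ₂0.le
    linarith
  have b3 : ∀ i, ‖u.2.2.1 i - lam - (h i)⁻¹ • (u.1 i - xs i)‖ ≤ ρ := fun i => by
    refine hsq (hhalf i) ?_ (hhρ i)
    have h1 := Finset.single_le_sum
      (f := fun i => h i * ‖u.2.2.1 i - lam - (h i)⁻¹ • (u.1 i - xs i)‖ ^ 2)
      (fun i _ => mul_nonneg (S.perron.pos i).le (sq_nonneg _)) (Finset.mem_univ i)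
    linarith
  have b4 : ∀ i, ‖u.2.2.2 i - E.2.2.2 i‖ ≤ ρ := fun i => by
    refine hsq (hhalf i) ?_ (hhρ i)
    have h1 := Finset.single_le_sum (f := fun i => h i * ‖u.2.2.2 i - E.2.2.2 i‖ ^ 2)
      (fun i _ => mul_nonneg (S.perron.pos i).le (sq_nonneg _)) (Finset.mem_univ i)
    linarith
  have b5 : ∀ i, ‖u.2.2.1 i - lam‖ ≤ ρ * (1 + K) := fun i => by
    have h1 := norm_add_le (u.2.2.1 i - lam - (h i)⁻¹ • (u.1 i - xs i))
      ((h i)⁻¹ • (u.1 i - xs i))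
    rw [sub_add_cancel, norm_smul, norm_inv, Real.norm_of_nonneg (S.perron.pos i).le] at h1
    have h2 : (h i)⁻¹ * ‖u.1 i - xs i‖ ≤ K * ρ :=
      mul_le_mul (S.inv_le i) (b1 i) (norm_nonneg _) hK0.le
    linarith [b3 i]
  have hρK : ρ ≤ ρ * (1 + K) := by nlinarith
  have hρK0 : 0 ≤ ρ * (1 + K) := hρ0.trans hρK
  have hdist : ‖u - E‖ ≤ ρ * (1 + K) := by
    refine max_le ?_ (max_le ?_ (max_le ?_ ?_))
    · exact (pi_norm_le_iff_of_nonneg hρK0).2 fun i => (b1 i).trans hρK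
    · exact (pi_norm_le_iff_of_nonneg hρK0).2 fun j =>
        (pi_norm_le_iff_of_nonneg hρK0).2 fun i => (b2 j i).trans hρK
    · exact (pi_norm_le_iff_of_nonneg hρK0).2 b5
    · exact (pi_norm_le_iff_of_nonneg hρK0).2 fun i => (b4 i).trans hρK
  have := norm_add_le (u - E) E
  rw [sub_add_cancel] at this
  linarith

/-- The Lyapunov function decreases on every `[0, T]`, so its sublevel set at the initial state is
an a priori bound independent of `T`. -/
theorem exists_solution (S : IsStableSetting hn G h α β γ η c K f0 f d xs lam us)
    (u₀ : PhaseSpace n q r) (hu₀ : u₀.2.2.2 = 0) :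
    ∃ u : ℝ → PhaseSpace n q r, u 0 = u₀ ∧
      ∀ t, 0 ≤ t → HasDerivWithinAt u (vectorField G h α γ f0 f d (u t)) (Ici 0) t := by
  obtain ⟨R, hR⟩ := S.exists_norm_le (lyapunov G h α γ η f0 f d xs lam us u₀)
  refine exists_global_solution (R := R) (fun R' =>
    (vectorField_locallyLipschitz S.smooth S.closed).locallyLipschitzOn
      |>.exists_lipschitzOnWith_of_compact (isCompact_closedBall 0 R')) ?_
  intro T hT u hu0 hu t ht
  have h0 : (0 : ℝ) ∈ Icc 0 T := left_mem_Icc.2 hT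
  have hw : (u 0).2.2.2 = 0 := by rw [hu0, hu₀]
  refine hR _ (S.sum_smul_eq_zero (convex_Icc 0 T) h0 hu hw ht) ?_
  have := S.antitoneOn_lyapunov (convex_Icc 0 T) h0 hu hw h0 ht ht.1
  simpa only [hu0] using this

theorem tendsto_solution (S : IsStableSetting hn G h α β γ η c K f0 f d xs lam us)
    {u : ℝ → PhaseSpace n q r} (hw : (u 0).2.2.2 = 0)
    (hu : ∀ t, 0 ≤ t → HasDerivWithinAt u (vectorField G h α γ f0 f d (u t)) (Ici 0) t) :
    Tendsto (fun t => (u t).1) atTop (𝓝 xs) := by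
  have hu' : ∀ t ∈ Ici (0 : ℝ), HasDerivWithinAt u (vectorField G h α γ f0 f d (u t)) (Ici 0) t :=
    fun t ht => hu t ht
  have h0 : (0 : ℝ) ∈ Ici (0 : ℝ) := self_mem_Ici
  have hsum := fun t (ht : t ∈ Ici (0 : ℝ)) => S.sum_smul_eq_zero (convex_Ici 0) h0 hu' hw ht
  obtain ⟨R, hR⟩ := S.exists_norm_le (lyapunov G h α γ η f0 f d xs lam us (u 0))
  have hbound : ∀ t ∈ Ici (0 : ℝ), ‖u t‖ ≤ R := fun t ht =>
    hR _ (hsum t ht) (S.antitoneOn_lyapunov (convex_Ici 0) h0 hu' hw h0 ht ht)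
  have hR0 : 0 ≤ R := (norm_nonneg _).trans (hbound 0 h0)
  obtain ⟨k, hk⟩ := (vectorField_locallyLipschitz (G := G) (h := h) (α := α) (γ := γ) (d := d)
    S.smooth S.closed).locallyLipschitzOn.exists_lipschitzOnWith_of_compact
      (isCompact_closedBall 0 R)
  -- A speed bound along the bounded trajectory; it bounds the derivative of `∑ ‖x - xs‖ ^ 2` from
  -- below, as Barbalat's lemma requires.
  set L := ‖vectorField G h α γ f0 f d 0‖ + k * R
  have hL0 : 0 ≤ L := by positivity
  have hL : ∀ t ∈ Ici (0 : ℝ), ‖vectorField G h α γ f0 f d (u t)‖ ≤ L := fun t ht => by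
    have h1 := hk.norm_sub_le (x := u t) (y := 0) (by simpa using hbound t ht)
      (Metric.mem_closedBall_self hR0)
    rw [sub_zero] at h1
    have h2 := norm_add_le (vectorField G h α γ f0 f d 0)
      (vectorField G h α γ f0 f d (u t) - vectorField G h α γ f0 f d 0)
    rw [add_sub_cancel] at h2
    have h3 : (k : ℝ) * ‖u t‖ ≤ k * R := mul_le_mul_of_nonneg_left (hbound t ht) k.2
    linarith
  choose! V' hV' hle using fun t (ht : t ∈ Ici (0 : ℝ)) =>
    S.hasDerivWithinAt_lyapunov (hu' t ht) (hsum t ht)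
  have hφ : ∀ t ∈ Ici (0 : ℝ), HasDerivWithinAt (fun τ => ∑ i, ‖(u τ).1 i - xs i‖ ^ 2)
      (∑ i, 2 * inner ℝ ((u t).1 i - xs i) ((vectorField G h α γ f0 f d (u t)).1 i)) (Ici 0) t :=
    fun t ht => HasDerivWithinAt.fun_sum fun i _ =>
      (((hasDerivWithinAt_phaseSpace_iff.1 (hu' t ht)).1 i).sub_const (xs i)).norm_sq
  have hterm : ∀ t ∈ Ici (0 : ℝ), ∀ i, -(2 * ((R + ‖xs‖) * L)) ≤
      2 * inner ℝ ((u t).1 i - xs i) ((vectorField G h α γ f0 f d (u t)).1 i) := fun t ht i => by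
    have h1 := (abs_le.1 (abs_real_inner_le_norm ((u t).1 i - xs i)
      ((vectorField G h α γ f0 f d (u t)).1 i))).1
    have h2 : ‖(u t).1 i - xs i‖ ≤ R + ‖xs‖ :=
      (norm_sub_le _ _).trans (add_le_add
        ((norm_le_pi_norm _ i).trans ((norm_fst_le (u t)).trans (hbound t ht)))
          (norm_le_pi_norm _ i))
    have h3 : ‖(vectorField G h α γ f0 f d (u t)).1 i‖ ≤ L :=
      (norm_le_pi_norm _ i).trans ((norm_fst_le _).trans (hL t ht))
    have h4 := mul_le_mul h2 h3 (norm_nonneg _) (by positivity)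
    linarith
  have hlim := tendsto_zero_of_dissipation
    (δ := (η + 1) * (c - 1 / 2 * (1 + γ) * r * (1 / β)) - K)
    (K := n * (2 * ((R + ‖xs‖) * L)) + 1) (by linarith [S.lt_dissipation]) (by positivity) hV' hle
    (fun t ht => by
      refine le_trans ?_ (S.le_lyapunov (hsum t ht))
      have c1 : 0 ≤ (η + 1) * (c - γ * r) - K := by linarith [S.lt_coercivity]
      have c2 := S.η_pos
      have c3 := S.γ_pos
      have c4 := fun i => (S.perron.pos i).le
      have c5 := fun i (a : EuclideanSpace ℝ (Fin q)) => mul_nonneg (c4 i) (sq_nonneg ‖a‖)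
      refine add_nonneg (add_nonneg (add_nonneg ?_ ?_) ?_) ?_
      · exact mul_nonneg c1 (Finset.sum_nonneg fun i _ => sq_nonneg _)
      · exact mul_nonneg (by positivity)
          (Finset.sum_nonneg fun i _ => Finset.sum_nonneg fun j _ => sq_nonneg _)
      · exact mul_nonneg (by norm_num) (Finset.sum_nonneg fun i _ => c5 i _)
      · exact mul_nonneg (by norm_num) (Finset.sum_nonneg fun i _ => c5 i _))
    hφ (fun t ht => by
      have h1 := Finset.sum_le_sum fun i (_ : i ∈ Finset.univ) => hterm t ht i
      rw [Finset.sum_const, Finset.card_univ, Fintype.card_fin, nsmul_eq_mul] at h1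
      linarith) (fun t ht => Finset.sum_nonneg fun i _ => sq_nonneg _)
  rw [tendsto_pi_nhds]
  intro i
  rw [tendsto_iff_norm_sub_tendsto_zero]
  have hsqrt : Tendsto (fun t => √(∑ i, ‖(u t).1 i - xs i‖ ^ 2)) atTop (𝓝 0) := by
    have h1 := (Real.continuous_sqrt.tendsto 0).comp hlim
    rw [Real.sqrt_zero] at h1
    exact h1
  refine squeeze_zero (fun t => norm_nonneg _) (fun t => ?_) hsqrt
  refine Real.le_sqrt_of_sq_le ?_
  exact Finset.single_le_sum (f := fun i => ‖(u t).1 i - xs i‖ ^ 2) (fun i _ => sq_nonneg _)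
    (Finset.mem_univ i)

end IsStableSetting

end Convergence

end ResourceAllocation

end

/-! ### The main theorem: the gain conditions give a stable setting. -/

theorem theorem1 {n q r : ℕ} (hn : 2 ≤ n) (hr : 1 ≤ r)
    -- the strongly connected digraph and its normalised left eigenvector
    (G : WeightedDigraph n) (hG : G.StronglyConnected)
    (h : Fin n → ℝ) (hh : G.IsLeftPerron h)
    -- the problem data
    (f0 : Fin n → EuclideanSpace ℝ (Fin q) → ℝ)
    (f : Fin n → Fin (r + 1) → EuclideanSpace ℝ (Fin q) → EReal)
    (d : Fin n → EuclideanSpace ℝ (Fin q))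
    (c : ℝ) (hc : (r : ℝ) < c)
    (hf0 : ∀ i, ContDiff ℝ 2 (f0 i))
    (hf0c : ∀ i a b, c * ‖a - b‖ ^ 2 ≤ inner ℝ (∇ (f0 i) a - ∇ (f0 i) b) (a - b))
    (hf : ∀ i j, IsClosedProperConvex (f i j))
    -- a feasible point in the relative interior of every effective domain
    (hfeas : ∃ y : Fin n → EuclideanSpace ℝ (Fin q), ∑ i, y i = ∑ i, d i ∧
      ∀ i j, y i ∈ intrinsicInterior ℝ (effDomain (f i j)))
    -- the parameters
    (α β γ η : ℝ) (hγ0 : 0 < γ) (hγ : γ < 1 / (r : ℝ))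
    (hβ1 : (1 + γ) * r / (2 * c) < β) (hβ2 : β < 2 / (1 + γ))
    (hα : (η + 1) ^ 2 /
      (η * secondSmallestEigenvalue hn (G.symLaplacian_isHermitian h)) < α)
    (hη : max (1 / ((c - 1 / 2 * (1 + γ) * r * (1 / β)) * ⨅ i, h i) - 1) 0 < η) :
    -- the problem has exactly one solution
    (∃! xs, IsSolution f0 f d xs) ∧
    -- the dynamics has a trajectory on `[0, ∞)` from every initial state with `w 0 = 0`
    (∀ (x₀ : Fin n → EuclideanSpace ℝ (Fin q)) (z₀ : Fin r → Fin n → EuclideanSpace ℝ (Fin q))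
      (v₀ : Fin n → EuclideanSpace ℝ (Fin q)),
      ∃ x z v w, IsTrajectory G h α γ f0 f d x z v w ∧ x 0 = x₀ ∧ z 0 = z₀ ∧ v 0 = v₀) ∧
    -- along every trajectory, `x t` converges to the solution
    (∀ x z v w, IsTrajectory G h α γ f0 f d x z v w →
      ∃ xs, IsSolution f0 f d xs ∧ Tendsto x atTop (𝓝 xs)) := by
  have hr0 : (0 : ℝ) < r := by exact_mod_cast hr
  have hc0 : 0 < c := hr0.trans hc
  have : Nonempty (Fin n) := ⟨⟨0, by omega⟩⟩
  obtain ⟨i₀, hi₀⟩ := exists_eq_ciInf_of_finite (f := h)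
  set hs := ⨅ i, h i
  have hs0 : 0 < hs := hi₀ ▸ hh.pos i₀
  have hs_le : ∀ i, hs ≤ h i := fun i => ciInf_le (Set.finite_range h).bddBelow i
  have hβ0 : 0 < β := lt_of_le_of_lt (by positivity) hβ1
  have hγ1 : 0 < 1 + γ := by linarith
  have hβγ : (1 + γ) * β ≤ 2 := by
    rw [lt_div_iff₀ hγ1] at hβ2
    linarith
  have hη0 : 0 < η := lt_of_le_of_lt (le_max_right _ _) hη
  have hη1 := lt_of_le_of_lt (le_max_left _ _) hη
  set b := c - 1 / 2 * (1 + γ) * r * (1 / β) with hb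
  have hb0 : 0 < b := by
    rw [div_lt_iff₀ (by positivity)] at hβ1
    have h1 : 1 / 2 * (1 + γ) * r * (1 / β) < c := by
      rw [mul_one_div, div_lt_iff₀ hβ0]
      linarith
    linarith
  -- The lower bound on `η` in the form used by the Lyapunov argument, with `K = 1 / hs`.
  have hdiss : 1 / hs < (η + 1) * b := by
    have h1 : 1 / (b * hs) < η + 1 := by linarith
    rw [div_lt_iff₀ (by positivity)] at h1
    rw [div_lt_iff₀ hs0]
    linarith
  -- Since `β (1 + γ) ≤ 2` and `4 γ ≤ (1 + γ) ^ 2`, one has `γ β ≤ (1 + γ) / 2`; the dissipation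
  -- margin therefore also gives coercivity.
  have hbγ : b ≤ c - γ * r := by
    have h1 : γ * β ≤ 1 / 2 * (1 + γ) := by nlinarith [sq_nonneg (1 - γ)]
    have h2 : γ * r ≤ 1 / 2 * (1 + γ) * r * (1 / β) := by
      rw [mul_one_div, le_div_iff₀ hβ0]
      nlinarith
    linarith
  obtain ⟨xs, hxs⟩ := exists_isSolution hf0 hc0 hf0c hf (by
    obtain ⟨y, hy, hyr⟩ := hfeas
    exact ⟨y, hy, fun i j => intrinsicInterior_subset (hyr i j)⟩)
  obtain ⟨lam, us, hk⟩ := hxs.exists_isKKT hf0 hf hfeas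
  have S : IsStableSetting hn G h α β γ η c (1 / hs) f0 f d xs lam us :=
    { connected := hG
      perron := hh
      smooth := hf0
      strongly_monotone := hf0c
      closed := hf
      kkt := hk
      γ_pos := hγ0
      β_pos := hβ0
      βγ_le := hβγ
      η_pos := hη0
      lt_α := hα
      inv_le := fun i => by
        rw [← one_div]
        exact one_div_le_one_div_of_le hs0 (hs_le i)
      lt_dissipation := hdiss
      lt_coercivity := hdiss.trans_le (mul_le_mul_of_nonneg_left hbγ (by linarith)) }
  refine ⟨⟨xs, hxs, fun x hx => hk.eq_of_isSolution hf0 hc0 hf0c hf hx⟩, ?_, ?_⟩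
  · intro x₀ z₀ v₀
    obtain ⟨u, hu0, hu⟩ := S.exists_solution (x₀, z₀, v₀, 0) rfl
    refine ⟨fun t => (u t).1, fun t => (u t).2.1, fun t => (u t).2.2.1, fun t => (u t).2.2.2,
      isTrajectory_iff.2 ⟨hu, ?_⟩, ?_, ?_, ?_⟩ <;> simp [hu0]
  · intro x z v w hT
    obtain ⟨hu, hw⟩ := isTrajectory_iff.1 hT
    exact ⟨xs, hxs, S.tendsto_solution (u := fun t => (x t, z t, v t, w t)) hw hu⟩
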